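/- Let $\tau\in\mathbb{C}$ with $\operatorname{Im}\tau>0$ and $q=e^{2\pi i\tau}$ (with $q^{r}=e^{2\pi i r\tau}$ for rational $r$). Write $(a;q)_\infty=\prod_{k\ge 0}(1-aq^k)$, $\eta(\tau)=q^{1/24}(q;q)_\infty$, and $$\theta_1(z|\tau)=2q^{1/8}\sum_{n=0}^\infty(-1)^nq^{n(n+1)/2}\sin((2n+1)z),\qquad \theta_4(z|\tau)=1+2\sum_{n=1}^\infty(-1)^nq^{n^2/2}\cos(2nz).$$ Then for every $z\in\mathbb{C}$ with $|\operatorname{Im}z|<\pi\operatorname{Im}\tau$ we have $\theta_4(z|2\tau)\neq 0$, the series below converges absolutely, and $$\sum_{n=1}^\infty\frac{q^n-q^{3n}-q^{5n}+q^{7n}}{1-q^{8n}}\sin 2nz=\frac{(q^4;q^4)_\infty(q^2;q^2)_\infty^2}{2(q^8;q^8)_\infty}\cdot\frac{\theta_1(2z|8\tau)}{\theta_4(z|2\tau)}.$$ Moreover the following specializations hold, all series being absolutely convergent, where $\left(\frac{n}{3}\right)$ is the Legendre symbol and $\left(\frac{-4}{n}\right)$ is the Kronecker symbol: $$\sum_{n=1}^\infty\frac{n(q^n-q^{3n}-q^{5n}+q^{7n})}{1-q^{8n}}=\frac{q(q^2;q^2)^3_\infty(q^4;q^4)_\infty(q^8;q^8)^2_\infty}{(q;q)^2_\infty}=\frac{\eta(2\tau)^3\eta(4\tau)\eta(8\tau)^2}{\eta(\tau)^2},$$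 $$\sum_{n=1}^\infty\left(\frac{n}{3}\right)\frac{q^n-q^{3n}-q^{5n}+q^{7n}}{1-q^{8n}}=\frac{q(q;q)_\infty(q^4;q^4)_\infty(q^6;q^6)_\infty(q^{24};q^{24})_\infty}{(q^3;q^3)_\infty(q^8;q^8)_\infty}=\frac{\eta(\tau)\eta(4\tau)\eta(6\tau)\eta(24\tau)}{\eta(3\tau)\eta(8\tau)},$$ $$\sum_{n=1}^\infty\left(\frac{-4}{n}\right)\frac{q^n-q^{3n}-q^{5n}+q^{7n}}{1-q^{8n}}=\frac{q(q^2;q^2)_\infty^2(q^{16};q^{16})_\infty^2}{(q^4;q^4)_\infty(q^8;q^8)_\infty}=\frac{\eta(2\tau)^2\eta(16\tau)^2}{\eta(4\tau)\eta(8\tau)}.$$ -/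

import Mathlib

noncomputable section

/-- The infinite `q`-shifted factorial `(a; q)_∞ = ∏_{k ≥ 0} (1 - a q^k)`. -/
def qPochInf (a q : ℂ) : ℂ := ∏' k : ℕ, (1 - a * q ^ k)

/-- `θ₁(z|τ) = 2 q^{1/8} ∑_{n ≥ 0} (-1)^n q^{n(n+1)/2} sin((2n+1)z)` with `q = exp(2πiτ)`
and `q^{1/8} = exp(πiτ/4)`. The exponent `n(n+1)/2` is an exact natural-number division. -/
def theta1 (z τ : ℂ) : ℂ :=
  2 * Complex.exp (Real.pi * Complex.I * τ / 4) *
    ∑' n : ℕ, (-1) ^ n * Complex.exp (2 * Real.pi * Complex.I * τ) ^ (n * (n + 1) / 2) *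
      Complex.sin ((2 * n + 1) * z)

/-- `θ₄(z|τ) = 1 + 2 ∑_{n ≥ 1} (-1)^n q^{n²/2} cos(2nz)` with `q = exp(2πiτ)`
and `q^{1/2} = exp(πiτ)`. -/
def theta4 (z τ : ℂ) : ℂ :=
  1 + 2 * ∑' n : ℕ+, (-1) ^ (n : ℕ) * Complex.exp (Real.pi * Complex.I * τ) ^ ((n : ℕ) ^ 2) *
    Complex.cos (2 * n * z)

/-- The coefficient `(q^n - q^{3n} - q^{5n} + q^{7n}) / (1 - q^{8n})` of the Lambert series. -/
def lambertCoeff8 (q : ℂ) (n : ℕ) : ℂ :=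
  (q ^ n - q ^ (3 * n) - q ^ (5 * n) + q ^ (7 * n)) / (1 - q ^ (8 * n))

end

/-!
The proof works with Laurent series in `x = exp (2 i z)` on the annulus `|q| < |x| < 1 / |q|`, which
is the strip `|Im z| < π Im τ`.

The Lambert coefficient simplifies to `cₙ = (qⁿ - q³ⁿ) / (1 + q⁴ⁿ)`, which makes sense for all
integers `n` and is odd in `n`; so the sine series is, up to the factor `1 / (2 i)`, the Laurent
series `L(x) = ∑ cₙ xⁿ`. Multiply it by `θ₄(z | 2τ) = ∑ (-1)ᵏ q^(k²) xᵏ`, and let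
`gₘ = ∑ₖ (-1)ᵏ q^(k²) c_{m-k}` be the coefficients of the product. In `g_{m+2} + q^(4m+4) gₘ` the
denominators of the `cₙ` cancel, and there remain two theta series whose terms cancel in pairs; hence
`g_{m+2} = -q^(4m+4) gₘ` (`thetaLambertCoeff_add_two`). As `g₀ = 0` by oddness, the product is `g₁`
times the Laurent series of `θ₁(2z | 8τ)`, up to an elementary factor (`theta_mul_lambert_eq`).

To find `g₁`, let `x` tend to the boundary point `1 / q`: there `L` has a simple pole, `θ₄` has a
simple zero, and all other factors of the Jacobi triple products are continuous
(`thetaLambertCoeff_one`). The triple product itself (`hasSum_jacobi_triple_product`) is the limit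
`n → ∞`, by dominated convergence, of the finite identity
`∏_{k < n} (1 - x p^(2k+1)) (1 - x⁻¹ p^(2k+1)) = ∑ⱼ (-1)ʲ p^(j²) xʲ [2n choose n+j]`,
where the Gaussian binomial coefficient has base `p²`. The product for `θ₄` also shows that it does
not vanish in the strip.

The three specializations are the limit of the identity divided by `z` as `z → 0`, and the values at
`z = π / 3` and at `z = π / 4`, where `sin 2nz` is a multiple of the quadratic character; the
products are then simplified by splitting them into residue classes and over roots of unity.
-/

open Filter Topology

/-! ### Infinite `q`-shifted factorials -/

lemma summable_norm_mul_pow {Q : ℂ} (hQ : ‖Q‖ < 1) (a : ℂ) :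
    Summable fun k : ℕ => ‖-(a * Q ^ k)‖ := by
  simpa using (summable_geometric_of_lt_one (norm_nonneg _) hQ).mul_left ‖a‖

lemma multipliable_one_sub_mul_pow {Q : ℂ} (hQ : ‖Q‖ < 1) (a : ℂ) :
    Multipliable fun k : ℕ => 1 - a * Q ^ k := by
  simpa [sub_eq_add_neg] using multipliable_one_add_of_summable (summable_norm_mul_pow hQ a)

lemma qPochInf_ne_zero {a Q : ℂ} (hQ : ‖Q‖ < 1) (ha : ∀ k : ℕ, a * Q ^ k ≠ 1) :
    qPochInf a Q ≠ 0 := by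
  have := tprod_one_add_ne_zero_of_summable (f := fun k : ℕ => -(a * Q ^ k))
    (fun k h => ha k (by linear_combination -h)) (summable_norm_mul_pow hQ a)
  simpa [qPochInf, sub_eq_add_neg] using this

lemma mul_pow_ne_one {a Q : ℂ} (hQ : ‖Q‖ < 1) (ha : ‖a‖ < 1) (k : ℕ) : a * Q ^ k ≠ 1 := by
  intro h
  have h1 : ‖a * Q ^ k‖ < 1 := by
    rw [norm_mul, norm_pow]
    exact mul_lt_one_of_nonneg_of_lt_one_left (norm_nonneg _) ha
      (pow_le_one₀ (norm_nonneg _) hQ.le)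
  simp [h] at h1

lemma qPochInf_ne_zero_of_norm_lt_one {a Q : ℂ} (hQ : ‖Q‖ < 1) (ha : ‖a‖ < 1) :
    qPochInf a Q ≠ 0 :=
  qPochInf_ne_zero hQ (mul_pow_ne_one hQ ha)

lemma qPochInf_eq_one_sub_mul {Q : ℂ} (hQ : ‖Q‖ < 1) (a : ℂ) :
    qPochInf a Q = (1 - a) * qPochInf (a * Q) Q := by
  have e : ∀ k : ℕ, 1 - a * Q ^ (k + 1) = 1 - a * Q * Q ^ k := fun k => by ring
  have h : Multipliable fun k : ℕ => 1 - a * Q ^ (k + 1) := by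
    simp_rw [e]
    exact multipliable_one_sub_mul_pow hQ (a * Q)
  have := tprod_eq_zero_mul' (f := fun k : ℕ => 1 - a * Q ^ k) h
  simp_rw [e] at this
  simpa [qPochInf] using this

lemma continuous_qPochInf {Q : ℂ} (hQ : ‖Q‖ < 1) : Continuous fun a => qPochInf a Q := by
  rw [continuous_iff_continuousAt]
  intro a
  have hs : Summable fun k : ℕ => (‖a‖ + 1) * ‖Q‖ ^ k :=
    (summable_geometric_of_lt_one (norm_nonneg _) hQ).mul_left _
  have := tendsto_tprod_one_add_of_dominated_convergence (𝓕 := 𝓝 a)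
    (f := fun b (k : ℕ) => -(b * Q ^ k)) (g := fun k => -(a * Q ^ k)) hs
    (fun k => (Continuous.tendsto (by fun_prop) a)) ?_
  · simpa [ContinuousAt, qPochInf, sub_eq_add_neg] using this
  · have h1 : ∀ᶠ b in 𝓝 a, ‖b‖ < ‖a‖ + 1 :=
      continuous_norm.continuousAt.eventually_lt continuousAt_const (by simp)
    filter_upwards [h1] with b hb k
    rw [norm_neg, norm_mul, norm_pow]
    gcongr

lemma norm_pow_lt_one {Q : ℂ} (hQ : ‖Q‖ < 1) {n : ℕ} (hn : n ≠ 0) : ‖Q ^ n‖ < 1 := by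
  rw [norm_pow]; exact pow_lt_one₀ (norm_nonneg _) hQ hn

/-- Splitting `(a; Q)_∞` into the factors of even and of odd index. -/
lemma qPochInf_sq_mul {Q : ℂ} (hQ : ‖Q‖ < 1) (a : ℂ) :
    qPochInf a (Q ^ 2) * qPochInf (a * Q) (Q ^ 2) = qPochInf a Q := by
  have hQ2 := norm_pow_lt_one hQ two_ne_zero
  have e : ∀ k : ℕ, a * Q ^ (2 * k + 1) = a * Q * (Q ^ 2) ^ k := fun k => by ring
  have := tprod_even_mul_odd (f := fun k : ℕ => 1 - a * Q ^ k)
    (by simpa [pow_mul] using multipliable_one_sub_mul_pow hQ2 a)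
    (by simpa [e] using multipliable_one_sub_mul_pow hQ2 (a * Q))
  simpa [qPochInf, pow_mul, e] using this

lemma qPochInf_mul_neg {Q : ℂ} (hQ : ‖Q‖ < 1) (a : ℂ) :
    qPochInf a Q * qPochInf (-a) Q = qPochInf (a ^ 2) (Q ^ 2) := by
  rw [qPochInf, qPochInf, qPochInf, ← (multipliable_one_sub_mul_pow hQ a).tprod_mul
    (multipliable_one_sub_mul_pow hQ (-a))]
  congr 1; ext k; ring

lemma qPochInf_mul_cube_roots {Q ω : ℂ} (hQ : ‖Q‖ < 1) (hω : 1 + ω + ω ^ 2 = 0) (a : ℂ) :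
    qPochInf a Q * qPochInf (ω * a) Q * qPochInf (ω ^ 2 * a) Q = qPochInf (a ^ 3) (Q ^ 3) := by
  have h := multipliable_one_sub_mul_pow hQ
  rw [qPochInf, qPochInf, qPochInf, qPochInf, ← (h a).tprod_mul (h (ω * a)),
    ← ((h a).mul (h (ω * a))).tprod_mul (h (ω ^ 2 * a))]
  congr 1; ext k
  have h3 : ω ^ 3 = 1 := by linear_combination (ω - 1) * hω
  rw [mul_assoc ω, mul_assoc (ω ^ 2), ← pow_mul, mul_comm 3 k, pow_mul, ← mul_pow]
  generalize a * Q ^ k = u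
  linear_combination (-u + ω * u ^ 2) * hω - u ^ 3 * h3

/-! ### The Jacobi triple product -/

/-- The reciprocal `1 / (Q; Q)_m` of the finite `q`-factorial, extended by `0` to negative `m`. -/
noncomputable def invQFactorial (Q : ℂ) (m : ℤ) : ℂ :=
  if 0 ≤ m then (∏ k ∈ Finset.range m.toNat, (1 - Q ^ (k + 1)))⁻¹ else 0

lemma invQFactorial_natCast (Q : ℂ) (n : ℕ) :
    invQFactorial Q n = (∏ k ∈ Finset.range n, (1 - Q ^ (k + 1)))⁻¹ := by
  simp [invQFactorial]

lemma one_sub_pow_succ_ne_zero {Q : ℂ} (hQ : ‖Q‖ < 1) (k : ℕ) : 1 - Q ^ (k + 1) ≠ 0 := by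
  have := mul_pow_ne_one hQ hQ k
  intro h
  exact this (by rw [← pow_succ']; linear_combination -h)

/-- The extension by zero is chosen so that this recurrence holds for every integer `m`. -/
lemma invQFactorial_sub_one {Q : ℂ} (hQ : ‖Q‖ < 1) (m : ℤ) :
    invQFactorial Q (m - 1) = (1 - Q ^ m) * invQFactorial Q m := by
  rcases lt_trichotomy m 0 with h | rfl | h
  · simp [invQFactorial, h.not_ge, show ¬ (1 ≤ m) by omega]
  · simp [invQFactorial]
  · obtain ⟨n, rfl⟩ : ∃ n : ℕ, m = n + 1 := ⟨(m - 1).toNat, by omega⟩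
    rw [add_sub_cancel_right, ← Nat.cast_succ, invQFactorial_natCast, invQFactorial_natCast,
      Nat.succ_eq_add_one, Finset.prod_range_succ, zpow_natCast, mul_inv, mul_left_comm,
      mul_inv_cancel₀ (one_sub_pow_succ_ne_zero hQ n), mul_one]

lemma tendsto_prod_one_sub_mul_pow {Q : ℂ} (hQ : ‖Q‖ < 1) (a : ℂ) :
    Tendsto (fun n : ℕ => ∏ k ∈ Finset.range n, (1 - a * Q ^ k)) atTop (𝓝 (qPochInf a Q)) :=
  (multipliable_one_sub_mul_pow hQ a).tendsto_prod_tprod_nat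

lemma tendsto_invQFactorial {Q : ℂ} (hQ : ‖Q‖ < 1) :
    Tendsto (fun n : ℕ => invQFactorial Q n) atTop (𝓝 (qPochInf Q Q)⁻¹) := by
  simp_rw [invQFactorial_natCast]
  refine Tendsto.inv₀ ?_ (qPochInf_ne_zero_of_norm_lt_one hQ hQ)
  simp_rw [pow_succ']
  exact tendsto_prod_one_sub_mul_pow hQ Q

lemma exists_norm_invQFactorial_le {Q : ℂ} (hQ : ‖Q‖ < 1) :
    ∃ C, 0 ≤ C ∧ ∀ m : ℤ, ‖invQFactorial Q m‖ ≤ C := by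
  obtain ⟨C, hC⟩ := (Metric.isBounded_range_of_tendsto _
    (tendsto_invQFactorial hQ)).exists_norm_le
  have hC' : ∀ n : ℕ, ‖invQFactorial Q n‖ ≤ C := fun n => hC _ ⟨n, rfl⟩
  have h0 : 0 ≤ C := (norm_nonneg _).trans (hC' 0)
  refine ⟨C, h0, fun m => ?_⟩
  rcases le_or_gt 0 m with h | h
  · lift m to ℕ using h
    exact hC' m
  · simp [invQFactorial, h.not_ge, h0]

/-- The finite form of the triple product: `(Q;Q)_{2n} / ((Q;Q)_{n+j} (Q;Q)_{n-j})` with `Q = p ^ 2`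
is the Gaussian binomial coefficient `[2n choose n+j]`, which vanishes for `|j| > n`. -/
lemma hasSum_finite_triple_product {p : ℂ} (hp0 : p ≠ 0) (hp : ‖p‖ < 1) {x : ℂ} (hx : x ≠ 0)
    (n : ℕ) :
    HasSum (fun j : ℤ => (-1) ^ j * p ^ (j ^ 2) * x ^ j *
        ((∏ k ∈ Finset.range (2 * n), (1 - (p ^ 2) ^ (k + 1))) *
          (invQFactorial (p ^ 2) (n + j) * invQFactorial (p ^ 2) (n - j))))
      ((∏ k ∈ Finset.range n, (1 - x * p * (p ^ 2) ^ k)) *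
        ∏ k ∈ Finset.range n, (1 - p / x * (p ^ 2) ^ k)) := by
  have hQ := norm_pow_lt_one hp two_ne_zero
  have hQ0 : p ^ 2 ≠ 0 := pow_ne_zero _ hp0
  induction n with
  | zero =>
    convert hasSum_single (0 : ℤ) _ using 1
    · simp [invQFactorial]
    · intro j hj
      rcases lt_or_gt_of_ne hj with h | h <;> simp [invQFactorial, h.not_ge]
  | succ n ih =>
    set c : ℤ → ℂ := fun j => (-1) ^ j * p ^ (j ^ 2) * x ^ j *
        ((∏ k ∈ Finset.range (2 * n), (1 - (p ^ 2) ^ (k + 1))) *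
          (invQFactorial (p ^ 2) (n + j) * invQFactorial (p ^ 2) (n - j))) with hc
    set P := (∏ k ∈ Finset.range n, (1 - x * p * (p ^ 2) ^ k)) *
      ∏ k ∈ Finset.range n, (1 - p / x * (p ^ 2) ^ k) with hP
    -- multiplication by `(1 - x p^(2n+1)) (1 - p^(2n+1) / x)` is a three-term recurrence
    have h1 := ((Equiv.subRight (1 : ℤ)).hasSum_iff.mpr ih).mul_left (-(x * p ^ (2 * n + 1)))
    have h2 := ((Equiv.addRight (1 : ℤ)).hasSum_iff.mpr ih).mul_left (-(p ^ (2 * n + 1) / x))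
    have h0 := ih.mul_left (1 + (p ^ (2 * n + 1)) ^ 2)
    have hval : (∏ k ∈ Finset.range (n + 1), (1 - x * p * (p ^ 2) ^ k)) *
        ∏ k ∈ Finset.range (n + 1), (1 - p / x * (p ^ 2) ^ k) =
        (1 + (p ^ (2 * n + 1)) ^ 2) * P + -(x * p ^ (2 * n + 1)) * P +
          -(p ^ (2 * n + 1) / x) * P := by
      rw [Finset.prod_range_succ, Finset.prod_range_succ, hP,
        show p ^ (2 * n + 1) = (p ^ 2) ^ n * p by ring]
      field_simp
      ring
    rw [hval]
    refine ((h0.add h1).add h2).congr_fun fun j => ?_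
    simp only [Function.comp, Equiv.subRight_apply, Equiv.coe_addRight, hc]
    have e1 : ((n + 1 : ℕ) : ℤ) + j = n + j + 1 := by push_cast; ring
    have e2 : ((n + 1 : ℕ) : ℤ) - j = n - j + 1 := by push_cast; ring
    have r1 : invQFactorial (p ^ 2) (n + j) =
        (1 - (p ^ 2) ^ ((n : ℤ) + j + 1)) * invQFactorial (p ^ 2) (n + j + 1) := by
      rw [← invQFactorial_sub_one hQ]; congr 1; ring
    have r2 : invQFactorial (p ^ 2) (n - j) =
        (1 - (p ^ 2) ^ ((n : ℤ) - j + 1)) * invQFactorial (p ^ 2) (n - j + 1) := by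
      rw [← invQFactorial_sub_one hQ]; congr 1; ring
    have r3 : invQFactorial (p ^ 2) (n + (j - 1)) =
        (1 - (p ^ 2) ^ ((n : ℤ) + j)) * invQFactorial (p ^ 2) (n + j) := by
      rw [← invQFactorial_sub_one hQ]; congr 1; ring
    have r4 : invQFactorial (p ^ 2) (n - (j + 1)) =
        (1 - (p ^ 2) ^ ((n : ℤ) - j)) * invQFactorial (p ^ 2) (n - j) := by
      rw [← invQFactorial_sub_one hQ]; congr 1; ring
    have r5 : (n : ℤ) - (j - 1) = n - j + 1 := by ring
    have r6 : (n : ℤ) + (j + 1) = n + j + 1 := by ring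
    rw [e1, e2, r5, r6, r3, r4, r1, r2, show 2 * (n + 1) = 2 * n + 1 + 1 by ring,
      Finset.prod_range_succ, Finset.prod_range_succ]
    generalize invQFactorial (p ^ 2) (n + j + 1) = A
    generalize invQFactorial (p ^ 2) (n - j + 1) = B
    generalize ∏ k ∈ Finset.range (2 * n), (1 - (p ^ 2) ^ (k + 1)) = D
    have s1 : (-1 : ℂ) ^ (j - 1) = -(-1) ^ j := by
      rw [zpow_sub_one₀ (by norm_num)]; norm_num
    have s2 : (-1 : ℂ) ^ (j + 1) = -(-1) ^ j := by
      rw [zpow_add_one₀ (by norm_num)]; norm_num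
    have s3 : p ^ ((j - 1) ^ 2) = p ^ (j ^ 2) * p / (p ^ j) ^ 2 := by
      rw [← zpow_natCast (p ^ j), ← zpow_mul, ← zpow_add_one₀ hp0, ← zpow_sub₀ hp0]
      congr 1; push_cast; ring
    have s4 : p ^ ((j + 1) ^ 2) = p ^ (j ^ 2) * p * (p ^ j) ^ 2 := by
      rw [← zpow_natCast (p ^ j), ← zpow_mul, ← zpow_add_one₀ hp0, ← zpow_add₀ hp0]
      congr 1; push_cast; ring
    have s5 : (p ^ 2) ^ ((n : ℤ) + j) = (p ^ n) ^ 2 * (p ^ j) ^ 2 := by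
      rw [zpow_add₀ hQ0, zpow_natCast, ← pow_mul, ← pow_mul, ← zpow_natCast p 2,
        ← zpow_natCast (p ^ j), ← zpow_mul, ← zpow_mul, mul_comm n 2, mul_comm _ j]
    have s6 : (p ^ 2) ^ ((n : ℤ) - j) = (p ^ n) ^ 2 / (p ^ j) ^ 2 := by
      rw [zpow_sub₀ hQ0, zpow_natCast, ← pow_mul, ← pow_mul, ← zpow_natCast p 2,
        ← zpow_natCast (p ^ j), ← zpow_mul, ← zpow_mul, mul_comm n 2, mul_comm _ j]
    rw [zpow_add_one₀ hQ0, zpow_add_one₀ hQ0, s5, s6, s1, s2, s3, s4, zpow_sub_one₀ hx,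
      zpow_add_one₀ hx]
    have hz : p ^ j ≠ 0 := zpow_ne_zero _ hp0
    rw [show (p ^ 2) ^ (2 * n + 1) = (p ^ n) ^ 4 * p ^ 2 by ring,
      show (p ^ 2) ^ (2 * n + 1 + 1) = (p ^ n) ^ 4 * p ^ 4 by ring,
      show p ^ (2 * n + 1) = (p ^ n) ^ 2 * p by ring]
    generalize p ^ j = u at *
    generalize p ^ n = v
    generalize p ^ (j ^ 2) = w
    generalize x ^ j = X
    field_simp
    ring

lemma summable_pow_sq_mul_pow {r : ℝ} (hr0 : 0 < r) (hr : r < 1) {y : ℝ} (hy : 0 < y) :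
    Summable fun n : ℕ => r ^ (n ^ 2) * y ^ n := by
  refine summable_of_ratio_test_tendsto_lt_one (l := 0) one_pos
    (.of_forall fun n => by positivity) ?_
  have h : ∀ n : ℕ, ‖r ^ ((n + 1) ^ 2) * y ^ (n + 1)‖ / ‖r ^ (n ^ 2) * y ^ n‖ =
      (r ^ 2) ^ n * (r * y) := fun n => by
    rw [Real.norm_of_nonneg (by positivity), Real.norm_of_nonneg (by positivity),
      div_eq_iff (by positivity)]
    ring
  simp_rw [h]
  simpa using (tendsto_pow_atTop_nhds_zero_of_lt_one (by positivity)
    (pow_lt_one₀ hr0.le hr two_ne_zero)).mul_const (r * y)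

lemma summable_norm_theta {p : ℂ} (hp0 : p ≠ 0) (hp : ‖p‖ < 1) {x : ℂ} (hx : x ≠ 0) :
    Summable fun j : ℤ => ‖(-1) ^ j * p ^ (j ^ 2) * x ^ j‖ := by
  have hr0 := norm_pos_iff.mpr hp0
  refine Summable.of_nat_of_neg ?_ ?_
  · refine (summable_pow_sq_mul_pow hr0 hp (norm_pos_iff.mpr hx)).congr fun n => ?_
    have : ‖p‖ ^ ((n : ℤ) ^ 2) = ‖p‖ ^ (n ^ 2) := by norm_cast
    simp [this]
  · refine (summable_pow_sq_mul_pow hr0 hp (norm_pos_iff.mpr (inv_ne_zero hx))).congr fun n => ?_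
    have : ‖p‖ ^ ((n : ℤ) ^ 2) = ‖p‖ ^ (n ^ 2) := by norm_cast
    simp [this]

/-- **Jacobi triple product**. -/
theorem hasSum_jacobi_triple_product {p : ℂ} (hp0 : p ≠ 0) (hp : ‖p‖ < 1) {x : ℂ} (hx : x ≠ 0) :
    HasSum (fun j : ℤ => (-1) ^ j * p ^ (j ^ 2) * x ^ j)
      (qPochInf (p ^ 2) (p ^ 2) * qPochInf (x * p) (p ^ 2) * qPochInf (p / x) (p ^ 2)) := by
  have hQ := norm_pow_lt_one hp two_ne_zero
  have hP := qPochInf_ne_zero_of_norm_lt_one hQ hQ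
  have hsum := summable_norm_theta hp0 hp hx
  have hD : Tendsto (fun n : ℕ => ∏ k ∈ Finset.range n, (1 - (p ^ 2) ^ (k + 1))) atTop
      (𝓝 (qPochInf (p ^ 2) (p ^ 2))) := by
    simp_rw [pow_succ' (p ^ 2)]
    exact tendsto_prod_one_sub_mul_pow hQ (p ^ 2)
  have h2 : Tendsto (fun n : ℕ => 2 * n) atTop atTop :=
    tendsto_id.const_mul_atTop' two_pos
  obtain ⟨C, hC0, hC⟩ := exists_norm_invQFactorial_le hQ
  obtain ⟨D, hD'⟩ := (Metric.isBounded_range_of_tendsto _ hD).exists_norm_le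
  have hD'' : ∀ n : ℕ, ‖∏ k ∈ Finset.range n, (1 - (p ^ 2) ^ (k + 1))‖ ≤ D :=
    fun n => hD' _ ⟨n, rfl⟩
  have hD0 : 0 ≤ D := (norm_nonneg _).trans (hD'' 0)
  have hshift : ∀ j : ℤ, Tendsto (fun n : ℕ => invQFactorial (p ^ 2) (n + j)) atTop
      (𝓝 (qPochInf (p ^ 2) (p ^ 2))⁻¹) := fun j => by
    have ht : Tendsto (fun n : ℕ => ((n : ℤ) + j).toNat) atTop atTop :=
      tendsto_atTop.mpr fun b => by
        filter_upwards [eventually_ge_atTop (b + j.natAbs)] with n hn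
        omega
    refine ((tendsto_invQFactorial hQ).comp ht).congr' ?_
    filter_upwards [eventually_ge_atTop j.natAbs] with n hn
    simp only [Function.comp]
    congr 1
    omega
  have key := tendsto_tsum_of_dominated_convergence (𝓕 := atTop)
    (f := fun (n : ℕ) (j : ℤ) => (-1) ^ j * p ^ (j ^ 2) * x ^ j *
        ((∏ k ∈ Finset.range (2 * n), (1 - (p ^ 2) ^ (k + 1))) *
          (invQFactorial (p ^ 2) (n + j) * invQFactorial (p ^ 2) (n - j))))
    (hsum.mul_right (D * (C * C)))
    (fun j => ((hD.comp h2).mul ((hshift j).mul (hshift (-j)))).const_mul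
      ((-1) ^ j * p ^ (j ^ 2) * x ^ j))
    (.of_forall fun n j => by
      rw [norm_mul, norm_mul (∏ k ∈ _, _), norm_mul (invQFactorial _ _)]
      gcongr
      exacts [hD'' _, hC _, hC _])
  simp_rw [fun n => (hasSum_finite_triple_product hp0 hp hx n).tsum_eq] at key
  have key2 := (tendsto_prod_one_sub_mul_pow hQ (x * p)).mul (tendsto_prod_one_sub_mul_pow hQ (p / x))
  have := tendsto_nhds_unique key key2
  rw [tsum_mul_right] at this
  have hval : ∑' j : ℤ, (-1) ^ j * p ^ (j ^ 2) * x ^ j =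
      qPochInf (p ^ 2) (p ^ 2) * qPochInf (x * p) (p ^ 2) * qPochInf (p / x) (p ^ 2) := by
    rw [mul_assoc, ← this]
    field_simp
  rw [← hval]
  exact hsum.of_norm.hasSum

/-! ### The theta functions as Laurent series and as products -/

lemma hasSum_theta_odd {q : ℂ} (hq0 : q ≠ 0) (hq : ‖q‖ < 1) {x : ℂ} (hx : x ≠ 0) :
    HasSum (fun m : ℤ => (-1) ^ m * q ^ (4 * m ^ 2 + 4 * m) * x ^ (2 * m + 1))
      (x * (qPochInf (q ^ 8) (q ^ 8) * qPochInf (x ^ 2 * q ^ 8) (q ^ 8) *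
        qPochInf (1 / x ^ 2) (q ^ 8))) := by
  have h := (hasSum_jacobi_triple_product (p := q ^ 4) (pow_ne_zero _ hq0)
    (norm_pow_lt_one hq four_ne_zero) (x := x ^ 2 * q ^ 4)
    (mul_ne_zero (pow_ne_zero _ hx) (pow_ne_zero _ hq0))).mul_left x
  have e1 : q ^ 4 / (x ^ 2 * q ^ 4) = 1 / x ^ 2 := by field_simp
  rw [e1, ← pow_mul, mul_assoc (x ^ 2), ← pow_add] at h
  refine h.congr_fun fun m => ?_
  rw [zpow_add₀ hq0, zpow_add_one₀ hx, mul_zpow, ← zpow_natCast, ← zpow_natCast x, ← zpow_mul,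
    ← zpow_mul, ← zpow_mul]
  push_cast
  ring

lemma hasSum_theta4 {q x z τ : ℂ} (hq : q = Complex.exp (2 * Real.pi * Complex.I * τ))
    (hq1 : ‖q‖ < 1) (hx : x = Complex.exp (2 * Complex.I * z)) :
    HasSum (fun j : ℤ => (-1) ^ j * q ^ (j ^ 2) * x ^ j) (theta4 z (2 * τ)) := by
  have hq0 : q ≠ 0 := hq ▸ Complex.exp_ne_zero _
  have hx0 : x ≠ 0 := hx ▸ Complex.exp_ne_zero _
  have hS := (summable_norm_theta hq0 hq1 hx0).of_norm.hasSum
  set S := ∑' j : ℤ, (-1) ^ j * q ^ (j ^ 2) * x ^ j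
  suffices h : theta4 z (2 * τ) = S by rwa [h]
  have hF : ∀ n : ℕ, (-1) ^ (n : ℤ) * q ^ ((n : ℤ) ^ 2) * x ^ (n : ℤ) +
      (-1) ^ (-(n : ℤ)) * q ^ ((-(n : ℤ)) ^ 2) * x ^ (-(n : ℤ)) =
      2 * ((-1) ^ n * q ^ (n ^ 2) * Complex.cos (2 * n * z)) := fun n => by
    have h1 : q ^ ((n : ℤ) ^ 2) = q ^ (n ^ 2) := by norm_cast
    have h2 : x ^ n = Complex.exp (2 * n * z * Complex.I) := by
      rw [hx, ← Complex.exp_nat_mul]; congr 1; ring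
    have h3 : (x ^ n)⁻¹ = Complex.exp (-(2 * n * z) * Complex.I) := by
      rw [h2, ← Complex.exp_neg]; congr 1; ring
    have h4 : ((-1 : ℂ) ^ n)⁻¹ = (-1) ^ n := by rw [← inv_pow]; norm_num
    rw [neg_sq, h1, zpow_neg, zpow_neg, zpow_natCast, zpow_natCast, h3, h4, h2, Complex.cos]
    ring
  have h := hS.nat_add_neg
  simp_rw [hF] at h
  have h' := (hasSum_pnat_iff (f := fun n : ℕ => 2 * ((-1) ^ n * q ^ (n ^ 2) *
    Complex.cos (2 * n * z))) (a := S - 1)).mpr (by convert h using 1; norm_num; ring)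
  rw [theta4, show Real.pi * Complex.I * (2 * τ) = 2 * Real.pi * Complex.I * τ by ring, ← hq,
    ← tsum_mul_left, h'.tsum_eq]
  ring

/-- The factor `-i q` comes from `x ^ k - x ^ (-k) = 2 i sin (2 k z)` and from
`exp (π i (8 τ) / 4) = q`. -/
lemma theta1_eq_neg_I_mul {q x z τ S : ℂ} (hq : q = Complex.exp (2 * Real.pi * Complex.I * τ))
    (hx : x = Complex.exp (2 * Complex.I * z))
    (hS : HasSum (fun m : ℤ => (-1) ^ m * q ^ (4 * m ^ 2 + 4 * m) * x ^ (2 * m + 1)) S) :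
    theta1 (2 * z) (8 * τ) = -Complex.I * q * S := by
  have hF : ∀ n : ℕ, (-1) ^ (n : ℤ) * q ^ (4 * (n : ℤ) ^ 2 + 4 * n) * x ^ (2 * (n : ℤ) + 1) +
      (-1) ^ (-((n : ℤ) + 1)) * q ^ (4 * (-((n : ℤ) + 1)) ^ 2 + 4 * (-((n : ℤ) + 1))) *
        x ^ (2 * (-((n : ℤ) + 1)) + 1) =
      2 * Complex.I * ((-1) ^ n * (q ^ 8) ^ (n * (n + 1) / 2) *
        Complex.sin ((2 * n + 1) * (2 * z))) := fun n => by
    have e : 8 * (n * (n + 1) / 2) = 4 * n ^ 2 + 4 * n := by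
      obtain ⟨k, hk⟩ := Nat.even_mul_succ_self n
      have : n * (n + 1) / 2 = k := by rw [hk]; omega
      rw [this]; linarith
    have h1 : q ^ (4 * (n : ℤ) ^ 2 + 4 * n) = (q ^ 8) ^ (n * (n + 1) / 2) := by
      rw [← pow_mul, e]; norm_cast
    have h2 : x ^ (2 * n + 1) = Complex.exp ((2 * n + 1) * (2 * z) * Complex.I) := by
      rw [hx, ← Complex.exp_nat_mul]; congr 1; push_cast; ring
    have h3 : (x ^ (2 * n + 1))⁻¹ = Complex.exp (-((2 * n + 1) * (2 * z)) * Complex.I) := by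
      rw [h2, ← Complex.exp_neg]; congr 1; ring
    have h4 : ((-1 : ℂ) ^ (n + 1))⁻¹ = (-1) ^ (n + 1) := by rw [← inv_pow]; norm_num
    have h5 : x ^ (2 * (n : ℤ) + 1) = x ^ (2 * n + 1) := by norm_cast
    have h6 : x ^ (2 * (-((n : ℤ) + 1)) + 1) = (x ^ (2 * n + 1))⁻¹ := by
      rw [← h5, ← zpow_neg]; ring_nf
    have h7 : (-1 : ℂ) ^ (-((n : ℤ) + 1)) = (-1) ^ (n + 1) := by
      rw [zpow_neg, ← h4]; norm_cast
    rw [show 4 * (-((n : ℤ) + 1)) ^ 2 + 4 * (-((n : ℤ) + 1)) = 4 * (n : ℤ) ^ 2 + 4 * n by ring,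
      h1, h5, h6, h7, h3, h2, zpow_natCast, Complex.sin]
    linear_combination (-(-1) ^ n * (q ^ 8) ^ (n * (n + 1) / 2) *
      (Complex.exp (-((2 * n + 1) * (2 * z)) * Complex.I) -
        Complex.exp ((2 * n + 1) * (2 * z) * Complex.I))) * Complex.I_sq
  have h := hS.nat_add_neg_add_one
  simp_rw [hF] at h
  rw [theta1, show 2 * Real.pi * Complex.I * (8 * τ) = (8 : ℕ) * (2 * Real.pi * Complex.I * τ) by
    push_cast; ring, Complex.exp_nat_mul, ← hq, show Real.pi * Complex.I * (8 * τ) / 4 =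
    2 * Real.pi * Complex.I * τ by ring, ← hq, ← h.tsum_eq, tsum_mul_left]
  linear_combination (2 * q * ∑' n : ℕ, ((-1) ^ n * (q ^ 8) ^ (n * (n + 1) / 2) *
    Complex.sin ((2 * n + 1) * (2 * z)))) * Complex.I_sq

/-! ### The Lambert coefficients on the integers -/

/-- The Lambert coefficient for every integer index. As
`(1 - q ^ 2) (1 - q ^ 4) / (1 - q ^ 8) = (1 - q ^ 2) / (1 + q ^ 4)`, the quotient defining
`lambertCoeff8 q n` reduces to this one, which extends to `n ≤ 0` as an odd function of `n`. -/
noncomputable def lambertCoeffInt (q : ℂ) (n : ℤ) : ℂ := (q ^ n - q ^ (3 * n)) / (1 + q ^ (4 * n))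

lemma one_add_zpow_ne_zero {q : ℂ} (hq0 : q ≠ 0) (hq : ‖q‖ < 1) (n : ℤ) :
    1 + q ^ (4 * n) ≠ 0 := by
  intro h
  have h1 : ‖q‖ ^ (4 * n) = 1 := by
    rw [← norm_zpow, show q ^ (4 * n) = -1 by linear_combination h]; simp
  rcases eq_or_ne n 0 with rfl | hn
  · norm_num at h
  · have h2 := (zpow_right_injective₀ (norm_pos_iff.mpr hq0) hq.ne)
      (h1.trans (zpow_zero ‖q‖).symm)
    omega

lemma lambertCoeffInt_mul {q : ℂ} (hq0 : q ≠ 0) (hq : ‖q‖ < 1) (n : ℤ) :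
    (1 + q ^ (4 * n)) * lambertCoeffInt q n = q ^ n - q ^ (3 * n) :=
  mul_div_cancel₀ _ (one_add_zpow_ne_zero hq0 hq n)

lemma lambertCoeffInt_zero (q : ℂ) : lambertCoeffInt q 0 = 0 := by simp [lambertCoeffInt]

lemma lambertCoeffInt_neg {q : ℂ} (hq0 : q ≠ 0) (hq : ‖q‖ < 1) (n : ℤ) :
    lambertCoeffInt q (-n) = -lambertCoeffInt q n := by
  have h1 := one_add_zpow_ne_zero hq0 hq n
  have hz : q ^ n ≠ 0 := zpow_ne_zero _ hq0
  have e3 : q ^ (3 * n) = (q ^ n) ^ 3 := by rw [← zpow_natCast, ← zpow_mul]; ring_nf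
  have e4 : q ^ (4 * n) = (q ^ n) ^ 4 := by rw [← zpow_natCast, ← zpow_mul]; ring_nf
  rw [lambertCoeffInt, lambertCoeffInt, mul_neg, mul_neg, zpow_neg, zpow_neg, zpow_neg, e3, e4]
  rw [e4] at h1
  generalize q ^ n = u at *
  have h2 : u ^ 4 + 1 ≠ 0 := by rwa [add_comm]
  field_simp
  ring

lemma lambertCoeffInt_natCast {q : ℂ} (hq0 : q ≠ 0) (hq : ‖q‖ < 1) {n : ℕ} (hn : n ≠ 0) :
    lambertCoeffInt q n = lambertCoeff8 q n := by
  have h1 := one_add_zpow_ne_zero hq0 hq n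
  have h2 : 1 - q ^ (8 * n) ≠ 0 := by
    obtain ⟨k, hk⟩ := Nat.exists_eq_succ_of_ne_zero (show 8 * n ≠ 0 by omega)
    rw [hk]
    exact one_sub_pow_succ_ne_zero hq k
  have e (k : ℕ) : q ^ ((k : ℤ) * n) = (q ^ n) ^ k := by
    rw [← pow_mul, mul_comm (k : ℤ)]; norm_cast
  have e3 := e 3
  have e4 := e 4
  push_cast at e3 e4
  rw [lambertCoeffInt, lambertCoeff8, div_eq_div_iff h1 h2, e3, e4, zpow_natCast, mul_comm 3,
    mul_comm 5, mul_comm 7, mul_comm 8, pow_mul, pow_mul, pow_mul, pow_mul]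
  ring

lemma one_sub_norm_le {q : ℂ} (hq : ‖q‖ < 1) (n : ℕ) :
    1 - ‖q‖ ^ 4 ≤ ‖1 + q ^ (4 * n)‖ := by
  rcases Nat.eq_zero_or_pos n with rfl | hn
  · have := pow_nonneg (norm_nonneg q) 4
    norm_num
    linarith
  · have h1 : ‖(1 : ℂ)‖ - ‖q ^ (4 * n)‖ ≤ ‖1 + q ^ (4 * n)‖ := norm_sub_le_norm_add _ _
    have h2 : ‖q ^ (4 * n)‖ ≤ ‖q‖ ^ 4 := by
      rw [norm_pow]
      exact pow_le_pow_of_le_one (norm_nonneg _) hq.le (by omega)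
    rw [norm_one] at h1
    linarith

lemma norm_lambertCoeffInt_natCast_le {q : ℂ} (hq : ‖q‖ < 1) (n : ℕ) :
    ‖lambertCoeffInt q n‖ ≤ 2 / (1 - ‖q‖ ^ 4) * ‖q‖ ^ n := by
  have hpos : 0 < 1 - ‖q‖ ^ 4 := sub_pos.mpr (pow_lt_one₀ (norm_nonneg _) hq four_ne_zero)
  have e : lambertCoeffInt q n = (q ^ n - q ^ (3 * n)) / (1 + q ^ (4 * n)) := by
    rw [lambertCoeffInt]; norm_cast
  rw [e, norm_div, div_mul_eq_mul_div]
  refine div_le_div₀ (by positivity) ?_ hpos (one_sub_norm_le hq n)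
  have h3 : ‖q ^ (3 * n)‖ ≤ ‖q‖ ^ n := by
    rw [norm_pow]
    exact pow_le_pow_of_le_one (norm_nonneg _) hq.le (by omega)
  have := norm_sub_le (q ^ n) (q ^ (3 * n))
  rw [norm_pow q n] at this
  linarith

/-- The Laurent series `∑ cₙ xⁿ` converges absolutely in the annulus `|q| < |x| < 1 / |q|`. -/
lemma summable_norm_lambertCoeffInt {q : ℂ} (hq0 : q ≠ 0) (hq : ‖q‖ < 1) {x : ℂ}
    (h1 : ‖q‖ * ‖x‖ < 1) (h2 : ‖q‖ < ‖x‖) :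
    Summable fun n : ℤ => ‖lambertCoeffInt q n * x ^ n‖ := by
  have hx : 0 < ‖x‖ := (norm_nonneg q).trans_lt h2
  have hpos : 0 < 1 - ‖q‖ ^ 4 := sub_pos.mpr (pow_lt_one₀ (norm_nonneg _) hq four_ne_zero)
  refine Summable.of_nat_of_neg ?_ ?_
  · refine .of_nonneg_of_le (fun _ => norm_nonneg _) (fun n => ?_)
      ((summable_geometric_of_lt_one (by positivity) h1).mul_left (2 / (1 - ‖q‖ ^ 4)))
    rw [norm_mul, mul_pow, ← mul_assoc, zpow_natCast, norm_pow]
    gcongr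
    exact norm_lambertCoeffInt_natCast_le hq n
  · have h3 : ‖q‖ * ‖x‖⁻¹ < 1 := by rwa [← div_eq_mul_inv, div_lt_one hx]
    refine .of_nonneg_of_le (fun _ => norm_nonneg _) (fun n => ?_)
      ((summable_geometric_of_lt_one (by positivity) h3).mul_left (2 / (1 - ‖q‖ ^ 4)))
    rw [norm_mul, mul_pow, ← mul_assoc, zpow_neg, zpow_natCast, norm_inv, norm_pow,
      lambertCoeffInt_neg hq0 hq, norm_neg, inv_pow]
    gcongr
    exact norm_lambertCoeffInt_natCast_le hq n

/-- The expansion `∑_{n ∈ ℤ} cₙ xⁿ = ∑_{n ≥ 1} cₙ (xⁿ - x⁻ⁿ)` turns the Laurent series into the sine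
series. -/
lemma hasSum_lambertCoeff8_mul_sin {q x z L : ℂ} (hq0 : q ≠ 0) (hq : ‖q‖ < 1)
    (hx : x = Complex.exp (2 * Complex.I * z))
    (hL : HasSum (fun n : ℤ => lambertCoeffInt q n * x ^ n) L) :
    HasSum (fun n : ℕ+ => lambertCoeff8 q n * Complex.sin (2 * n * z)) (-Complex.I / 2 * L) := by
  have h := (hL.nat_add_neg).mul_left (-Complex.I / 2)
  have hF : ∀ n : ℕ, -Complex.I / 2 * (lambertCoeffInt q n * x ^ (n : ℤ) +
      lambertCoeffInt q (-n) * x ^ (-(n : ℤ))) =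
      lambertCoeffInt q n * Complex.sin (2 * n * z) := fun n => by
    have h2 : x ^ n = Complex.exp (2 * n * z * Complex.I) := by
      rw [hx, ← Complex.exp_nat_mul]; congr 1; ring
    have h3 : (x ^ n)⁻¹ = Complex.exp (-(2 * n * z) * Complex.I) := by
      rw [h2, ← Complex.exp_neg]; congr 1; ring
    rw [lambertCoeffInt_neg hq0 hq, zpow_neg, zpow_natCast, h3, h2, Complex.sin]
    ring
  simp_rw [hF] at h
  have h' := (hasSum_pnat_iff (f := fun n : ℕ => lambertCoeffInt q n * Complex.sin (2 * n * z))
    (a := -Complex.I / 2 * L)).mpr (by simpa [lambertCoeffInt_zero] using h)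
  refine h'.congr_fun fun n => ?_
  rw [lambertCoeffInt_natCast hq0 hq n.ne_zero]

/-! ### The product of the Laurent series with `θ₄` -/

/-- The `m`-th Laurent coefficient of the product of `∑ (-1)ᵏ q^(k²) xᵏ` and `∑ cₙ xⁿ`. -/
noncomputable def thetaLambertCoeff (q : ℂ) (m : ℤ) : ℂ :=
  ∑' k : ℤ, (-1) ^ k * q ^ (k ^ 2) * lambertCoeffInt q (m - k)

lemma tsum_eq_zero_of_comp_equiv_eq_neg {f : ℤ → ℂ} (e : ℤ ≃ ℤ) (h : ∀ k, f (e k) = -f k) :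
    ∑' k, f k = 0 := by
  have h1 := e.tsum_eq f
  simp_rw [h, tsum_neg] at h1
  linear_combination (-1 / 2) * h1

lemma hasSum_theta_mul_lambert {q x T L : ℂ} (hq0 : q ≠ 0) (hq : ‖q‖ < 1)
    (h1 : ‖q‖ * ‖x‖ < 1) (h2 : ‖q‖ < ‖x‖)
    (hT : HasSum (fun j : ℤ => (-1) ^ j * q ^ (j ^ 2) * x ^ j) T)
    (hL : HasSum (fun n : ℤ => lambertCoeffInt q n * x ^ n) L) :
    (∀ m : ℤ, Summable fun k : ℤ => (-1) ^ k * q ^ (k ^ 2) * lambertCoeffInt q (m - k)) ∧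
    HasSum (fun m : ℤ => thetaLambertCoeff q m * x ^ m) (T * L) := by
  have hx : x ≠ 0 := norm_pos_iff.mp ((norm_nonneg q).trans_lt h2)
  have hTs := summable_norm_theta hq0 hq hx
  have hLs := summable_norm_lambertCoeffInt hq0 hq h1 h2
  have hprod : HasSum (fun y : ℤ × ℤ => (-1) ^ y.1 * q ^ (y.1 ^ 2) * x ^ y.1 *
      (lambertCoeffInt q y.2 * x ^ y.2)) (T * L) := by
    have := (summable_mul_of_summable_norm hTs hLs).hasSum
    rwa [← tsum_mul_tsum_of_summable_norm hTs hLs, hT.tsum_eq, hL.tsum_eq] at this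
  let e : ℤ × ℤ ≃ ℤ × ℤ :=
    { toFun := fun y => (y.2, y.1 - y.2)
      invFun := fun y => (y.1 + y.2, y.1)
      left_inv := fun y => by simp
      right_inv := fun y => by simp }
  have hsum : HasSum (fun y : ℤ × ℤ => x ^ y.1 *
      ((-1) ^ y.2 * q ^ (y.2 ^ 2) * lambertCoeffInt q (y.1 - y.2))) (T * L) := by
    refine ((e.hasSum_iff (f := fun y : ℤ × ℤ => (-1) ^ y.1 * q ^ (y.1 ^ 2) * x ^ y.1 *
      (lambertCoeffInt q y.2 * x ^ y.2))).mpr hprod).congr_fun fun y => ?_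
    simp only [Function.comp, e, Equiv.coe_fn_mk]
    rw [zpow_sub₀ hx]
    field_simp
  have hfib : ∀ m : ℤ, Summable fun k : ℤ =>
      (-1) ^ k * q ^ (k ^ 2) * lambertCoeffInt q (m - k) := fun m =>
    (summable_mul_left_iff (zpow_ne_zero m hx)).mp (hsum.summable.prod_factor m)
  refine ⟨hfib, (hsum.prod_fiberwise fun m => (hfib m).hasSum.mul_left (x ^ m)).congr_fun
    fun m => mul_comm _ _⟩

lemma thetaLambertCoeff_zero {q : ℂ} (hq0 : q ≠ 0) (hq : ‖q‖ < 1) :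
    thetaLambertCoeff q 0 = 0 := by
  refine tsum_eq_zero_of_comp_equiv_eq_neg (Equiv.neg ℤ) fun k => ?_
  simp only [Equiv.neg_apply, zero_sub, neg_sq]
  rw [lambertCoeffInt_neg hq0 hq (-k), zpow_neg, ← inv_zpow]
  norm_num

/-- The coefficients satisfy a two-term recurrence: `1 + q ^ (4 n)` cancels the denominator of
`lambertCoeffInt q n`, and what remains are two theta series that vanish because their terms are
odd under `k ↦ -3 - k` and `k ↦ -1 - k`. -/
lemma thetaLambertCoeff_add_two {q : ℂ} (hq0 : q ≠ 0) (hq : ‖q‖ < 1)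
    (hs : ∀ m : ℤ, Summable fun k : ℤ => (-1) ^ k * q ^ (k ^ 2) * lambertCoeffInt q (m - k))
    (m : ℤ) : thetaLambertCoeff q (m + 2) = -q ^ (4 * m + 4) * thetaLambertCoeff q m := by
  have hneg : ∀ k : ℤ, (-1 : ℂ) ^ (-k) = (-1) ^ k := fun k => by
    rw [zpow_neg, ← inv_zpow]; norm_num
  have hvan : ∀ s : ℤ, (-1 : ℂ) ^ s = -1 →
      ∑' k : ℤ, (-1) ^ k * q ^ (k ^ 2) * (q ^ s) ^ k = 0 := fun s hs => by
    refine tsum_eq_zero_of_comp_equiv_eq_neg (Equiv.subLeft (-s)) fun k => ?_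
    simp only [Equiv.subLeft_apply]
    rw [← zpow_mul, ← zpow_mul, mul_assoc, ← zpow_add₀ hq0, mul_assoc, ← zpow_add₀ hq0,
      zpow_sub₀ (by norm_num), hneg, hs,
      div_eq_mul_inv, ← zpow_neg, hneg]
    rw [show (-s - k) ^ 2 + s * (-s - k) = k ^ 2 + s * k by ring]
    ring
  have h3 : Summable fun k : ℤ => (-1) ^ k * q ^ (k ^ 2) * (q ^ (3 : ℤ)) ^ k :=
    (summable_norm_theta hq0 hq (zpow_ne_zero 3 hq0)).of_norm
  have h1 : Summable fun k : ℤ => (-1) ^ k * q ^ (k ^ 2) * (q ^ (1 : ℤ)) ^ k :=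
    (summable_norm_theta hq0 hq (zpow_ne_zero 1 hq0)).of_norm
  have hA : thetaLambertCoeff q (m + 2) =
      ∑' k : ℤ, (-1) ^ (k + 2) * q ^ ((k + 2) ^ 2) * lambertCoeffInt q (m - k) := by
    rw [thetaLambertCoeff, ← (Equiv.addRight (2 : ℤ)).tsum_eq]
    congr 1; ext k
    rw [Equiv.coe_addRight, show m + 2 - (k + 2) = m - k by ring]
  have hAs : Summable fun k : ℤ =>
      (-1) ^ (k + 2) * q ^ ((k + 2) ^ 2) * lambertCoeffInt q (m - k) := by
    refine ((Equiv.addRight (2 : ℤ)).summable_iff.mpr (hs (m + 2))).congr fun k => ?_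
    simp only [Function.comp, Equiv.coe_addRight]
    rw [show m + 2 - (k + 2) = m - k by ring]
  have hterm : ∀ k : ℤ, (-1) ^ (k + 2) * q ^ ((k + 2) ^ 2) * lambertCoeffInt q (m - k) +
      q ^ (4 * m + 4) * ((-1) ^ k * q ^ (k ^ 2) * lambertCoeffInt q (m - k)) =
      q ^ (m + 4) * ((-1) ^ k * q ^ (k ^ 2) * (q ^ (3 : ℤ)) ^ k) -
      q ^ (3 * m + 4) * ((-1) ^ k * q ^ (k ^ 2) * (q ^ (1 : ℤ)) ^ k) := fun k => by
    have hc := lambertCoeffInt_mul hq0 hq (m - k)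
    have a1 : (-1 : ℂ) ^ (k + 2) = (-1) ^ k := by rw [zpow_add₀ (by norm_num)]; norm_num
    have a2 : q ^ ((k + 2) ^ 2) = q ^ (k ^ 2) * q ^ (4 * k + 4) := by
      rw [← zpow_add₀ hq0]; ring_nf
    have a3 : q ^ (4 * m + 4) = q ^ (4 * k + 4) * q ^ (4 * (m - k)) := by
      rw [← zpow_add₀ hq0]; ring_nf
    have a4 : q ^ (m + 4) * (q ^ (3 : ℤ)) ^ k = q ^ (4 * k + 4) * q ^ (m - k) := by
      rw [← zpow_mul, ← zpow_add₀ hq0, ← zpow_add₀ hq0]; ring_nf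
    have a5 : q ^ (3 * m + 4) * (q ^ (1 : ℤ)) ^ k = q ^ (4 * k + 4) * q ^ (3 * (m - k)) := by
      rw [← zpow_mul, ← zpow_add₀ hq0, ← zpow_add₀ hq0]; ring_nf
    rw [a1, a2, a3]
    linear_combination ((-1) ^ k * q ^ (k ^ 2)) * (q ^ (4 * k + 4) * hc - a4 + a5)
  have hB := (hAs.tsum_add ((hs m).mul_left (q ^ (4 * m + 4))))
  simp_rw [hterm] at hB
  rw [(h3.mul_left _).tsum_sub (h1.mul_left _), tsum_mul_left, tsum_mul_left, hvan 3 (by norm_num),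
    hvan 1 (by norm_num), tsum_mul_left, ← hA] at hB
  change _ = thetaLambertCoeff q (m + 2) + _ * thetaLambertCoeff q m at hB
  linear_combination -hB

lemma thetaLambertCoeff_two_mul {q : ℂ} (hq0 : q ≠ 0) (hq : ‖q‖ < 1)
    (hs : ∀ m : ℤ, Summable fun k : ℤ => (-1) ^ k * q ^ (k ^ 2) * lambertCoeffInt q (m - k))
    (m : ℤ) : thetaLambertCoeff q (2 * m) = 0 := by
  have hrec := thetaLambertCoeff_add_two hq0 hq hs
  induction m using Int.induction_on with
  | zero => simpa using thetaLambertCoeff_zero hq0 hq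
  | succ n ih => rw [mul_add, mul_one, hrec, ih, mul_zero]
  | pred n ih =>
    have h := hrec (2 * (-(n : ℤ) - 1))
    rw [show 2 * (-(n : ℤ) - 1) + 2 = 2 * -n by ring, ih] at h
    exact (mul_eq_zero.mp h.symm).resolve_left (neg_ne_zero.mpr (zpow_ne_zero _ hq0))

lemma thetaLambertCoeff_two_mul_add_one {q : ℂ} (hq0 : q ≠ 0) (hq : ‖q‖ < 1)
    (hs : ∀ m : ℤ, Summable fun k : ℤ => (-1) ^ k * q ^ (k ^ 2) * lambertCoeffInt q (m - k))
    (m : ℤ) : thetaLambertCoeff q (2 * m + 1) =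
      (-1) ^ m * q ^ (4 * m ^ 2 + 4 * m) * thetaLambertCoeff q 1 := by
  have hrec := thetaLambertCoeff_add_two hq0 hq hs
  have hstep : ∀ j : ℤ, (-1 : ℂ) ^ (j + 1) * q ^ (4 * (j + 1) ^ 2 + 4 * (j + 1)) =
      -q ^ (4 * (2 * j + 1) + 4) * ((-1) ^ j * q ^ (4 * j ^ 2 + 4 * j)) := fun j => by
    rw [zpow_add_one₀ (by norm_num), show 4 * (j + 1) ^ 2 + 4 * (j + 1) =
      4 * (2 * j + 1) + 4 + (4 * j ^ 2 + 4 * j) by ring, zpow_add₀ hq0]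
    ring
  induction m using Int.induction_on with
  | zero => simp
  | succ n ih =>
    rw [show 2 * ((n : ℤ) + 1) + 1 = 2 * n + 1 + 2 by ring, hrec, ih, hstep]
    ring
  | pred n ih =>
    have h := hrec (2 * (-(n : ℤ) - 1) + 1)
    have h' := hstep (-(n : ℤ) - 1)
    rw [show -(n : ℤ) - 1 + 1 = -n by ring] at h'
    rw [show 2 * (-(n : ℤ) - 1) + 1 + 2 = 2 * -n + 1 by ring, ih, h', mul_assoc] at h
    exact (mul_left_cancel₀ (neg_ne_zero.mpr (zpow_ne_zero _ hq0)) h).symm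

/-- The product of the two Laurent series is a multiple of the theta series of `θ₁(2z | 8τ)`. -/
lemma theta_mul_lambert_eq {q x T L S : ℂ} (hq0 : q ≠ 0) (hq : ‖q‖ < 1)
    (h1 : ‖q‖ * ‖x‖ < 1) (h2 : ‖q‖ < ‖x‖)
    (hT : HasSum (fun j : ℤ => (-1) ^ j * q ^ (j ^ 2) * x ^ j) T)
    (hL : HasSum (fun n : ℤ => lambertCoeffInt q n * x ^ n) L)
    (hS : HasSum (fun m : ℤ => (-1) ^ m * q ^ (4 * m ^ 2 + 4 * m) * x ^ (2 * m + 1)) S) :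
    T * L = thetaLambertCoeff q 1 * S := by
  obtain ⟨hs, hTL⟩ := hasSum_theta_mul_lambert hq0 hq h1 h2 hT hL
  have hinj : Function.Injective fun m : ℤ => 2 * m + 1 := fun a b h => by
    simp only at h; omega
  have h := (hinj.hasSum_iff (f := fun m : ℤ => thetaLambertCoeff q m * x ^ m) fun m hm => by
    rcases Int.even_or_odd' m with ⟨k, rfl | rfl⟩
    · simp [thetaLambertCoeff_two_mul hq0 hq hs]
    · exact absurd ⟨k, rfl⟩ hm).mpr hTL
  refine h.unique ((hS.mul_left (thetaLambertCoeff q 1)).congr_fun fun m => ?_)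
  simp only [Function.comp, thetaLambertCoeff_two_mul_add_one hq0 hq hs]
  ring

/-! ### The multiplier -/

/-- Near `x = 1 / q` the Laurent series `∑ cₙ xⁿ` has principal part `1 / (1 - q x)`. -/
lemma exists_norm_lambert_sub_le {q : ℂ} (hq0 : q ≠ 0) (hq : ‖q‖ < 1) :
    ∃ M : ℝ, ∀ t : ℝ, ‖q‖ < t → t < 1 → ∀ L : ℂ,
      HasSum (fun n : ℤ => lambertCoeffInt q n * (t / q) ^ n) L → ‖L - (1 - t : ℂ)⁻¹‖ ≤ M := by
  have hr := norm_pos_iff.mpr hq0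
  have hpos : 0 < 1 - ‖q‖ ^ 4 := sub_pos.mpr (pow_lt_one₀ (norm_nonneg _) hq four_ne_zero)
  have hgeo := ((hasSum_geometric_of_lt_one hr.le hq).mul_left (2 * (2 / (1 - ‖q‖ ^ 4))))
  refine ⟨2 * (2 / (1 - ‖q‖ ^ 4)) * (1 - ‖q‖)⁻¹, fun t ht0 ht1 L hL => ?_⟩
  have htpos : 0 < t := hr.trans ht0
  have ht : ‖(t : ℂ)‖ = t := by simp [abs_of_pos htpos]
  have htc : (t : ℂ) ≠ 0 := by exact_mod_cast htpos.ne'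
  have hg := hasSum_geometric_of_norm_lt_one (ξ := (t : ℂ)) (by rwa [ht])
  have hF := hL.nat_add_neg
  rw [lambertCoeffInt_zero, zero_mul, add_zero] at hF
  refine (hF.sub hg).norm_le_of_bounded hgeo fun n => ?_
  have hn0 : 1 + q ^ (4 * n) ≠ 0 := by
    have := one_add_zpow_ne_zero hq0 hq n
    exact_mod_cast this
  have hc := norm_lambertCoeffInt_natCast_le hq n
  have e : lambertCoeffInt q n = (q ^ n - q ^ (3 * n)) / (1 + q ^ (4 * n)) := by
    rw [lambertCoeffInt]; norm_cast
  have hqn : q ^ n ≠ 0 := pow_ne_zero _ hq0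
  have hsplit : lambertCoeffInt q n * (t / q) ^ (n : ℤ) +
      lambertCoeffInt q (-n) * (t / q) ^ (-(n : ℤ)) - (t : ℂ) ^ n =
      -((q ^ (2 * n) + q ^ (4 * n)) / (1 + q ^ (4 * n))) * t ^ n -
        lambertCoeffInt q n * (q / t) ^ n := by
    rw [lambertCoeffInt_neg hq0 hq, zpow_neg, zpow_natCast, ← inv_pow, inv_div, neg_mul,
      add_sub_right_comm, ← sub_eq_add_neg]
    congr 1
    rw [e, div_pow, mul_comm 3, mul_comm 4, mul_comm 2, pow_mul, pow_mul, pow_mul]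
    rw [mul_comm 4, pow_mul] at hn0
    generalize q ^ n = u at *
    field_simp
    ring
  rw [hsplit]
  have hle : ∀ k, k ≠ 0 → ‖q ^ (k * n)‖ ≤ ‖q‖ ^ n := fun k hk => by
    rw [norm_pow]
    exact pow_le_pow_of_le_one hr.le hq.le (Nat.le_mul_of_pos_left _ (Nat.pos_of_ne_zero hk))
  have b1 : ‖-((q ^ (2 * n) + q ^ (4 * n)) / (1 + q ^ (4 * n))) * (t : ℂ) ^ n‖ ≤
      2 / (1 - ‖q‖ ^ 4) * ‖q‖ ^ n := by
    have ha : ‖(q ^ (2 * n) + q ^ (4 * n)) / (1 + q ^ (4 * n))‖ ≤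
        2 / (1 - ‖q‖ ^ 4) * ‖q‖ ^ n := by
      rw [norm_div, div_mul_eq_mul_div]
      refine div_le_div₀ (by positivity) ?_ hpos (one_sub_norm_le hq n)
      have := norm_add_le (q ^ (2 * n)) (q ^ (4 * n))
      linarith [hle 2 two_ne_zero, hle 4 four_ne_zero]
    rw [norm_mul, norm_neg, norm_pow, ht]
    exact (mul_le_of_le_one_right (norm_nonneg _) (pow_le_one₀ htpos.le ht1.le)).trans ha
  have b2 : ‖lambertCoeffInt q n * (q / t) ^ n‖ ≤ 2 / (1 - ‖q‖ ^ 4) * ‖q‖ ^ n := by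
    rw [norm_mul, norm_pow, norm_div, ht]
    exact (mul_le_of_le_one_right (norm_nonneg _)
      (pow_le_one₀ (by positivity) ((div_le_one htpos).mpr ht0.le))).trans hc
  have := norm_sub_le (-((q ^ (2 * n) + q ^ (4 * n)) / (1 + q ^ (4 * n))) * (t : ℂ) ^ n)
    (lambertCoeffInt q n * (q / t) ^ n)
  linarith

lemma qPochInf_self_pow_ne_zero {q : ℂ} (hq : ‖q‖ < 1) {k : ℕ} (hk : k ≠ 0) :
    qPochInf (q ^ k) (q ^ k) ≠ 0 :=
  qPochInf_ne_zero_of_norm_lt_one (norm_pow_lt_one hq hk) (norm_pow_lt_one hq hk)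

/-- Both sides of `theta_mul_lambert_eq` extend continuously to the boundary point `x = 1 / q`, where
the simple zero of `θ₄` cancels the pole of the Lambert series; comparing the two values there gives
the multiplier. -/
lemma thetaLambertCoeff_one {q : ℂ} (hq0 : q ≠ 0) (hq : ‖q‖ < 1) :
    thetaLambertCoeff q 1 = q * (qPochInf (q ^ 4) (q ^ 4) * qPochInf (q ^ 2) (q ^ 2) ^ 2 /
      qPochInf (q ^ 8) (q ^ 8)) := by
  have hr := norm_pos_iff.mpr hq0
  have hq2 := norm_pow_lt_one hq two_ne_zero
  have hq8 := norm_pow_lt_one hq (show 8 ≠ 0 by norm_num)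
  obtain ⟨M, hM⟩ := exists_norm_lambert_sub_le hq0 hq
  have hev : ∀ᶠ t : ℝ in 𝓝[<] 1, ‖q‖ < t ∧ t < 1 := by
    filter_upwards [Ioo_mem_nhdsLT hq] with t ht using ht
  have hcast : Tendsto (fun t : ℝ => (t : ℂ)) (𝓝[<] 1) (𝓝 1) := by
    have := (Complex.continuous_ofReal.tendsto (1 : ℝ)).mono_left
      (nhdsWithin_le_nhds (s := Set.Iio 1))
    simpa using this
  let L : ℝ → ℂ := fun t => ∑' n : ℤ, lambertCoeffInt q n * (t / q) ^ n
  have hnorm : ∀ t : ℝ, ‖q‖ < t → ‖(t : ℂ) / q‖ = t / ‖q‖ := fun t h => by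
    rw [norm_div, Complex.norm_real, Real.norm_of_nonneg (hr.trans h).le]
  have hLs : ∀ t : ℝ, ‖q‖ < t → t < 1 →
      HasSum (fun n : ℤ => lambertCoeffInt q n * (t / q) ^ n) (L t) := fun t h0 h1 => by
    refine (summable_norm_lambertCoeffInt hq0 hq ?_ ?_).of_norm.hasSum
    · rw [hnorm t h0, mul_div_cancel₀ _ hr.ne']
      exact h1
    · rw [hnorm t h0, lt_div_iff₀ hr]
      nlinarith
  have hlimL : Tendsto (fun t : ℝ => (1 - t : ℂ) * L t) (𝓝[<] 1) (𝓝 1) := by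
    have h0 : Tendsto (fun t : ℝ => (1 - t : ℂ) * (L t - (1 - t : ℂ)⁻¹)) (𝓝[<] 1) (𝓝 0) := by
      refine Tendsto.zero_mul_isBoundedUnder_le (by simpa using hcast.const_sub 1) ?_
      refine ⟨M, ?_⟩
      rw [eventually_map]
      filter_upwards [hev] with t ht
      exact hM t ht.1 ht.2 _ (hLs t ht.1 ht.2)
    have h1 := h0.add_const 1
    rw [zero_add] at h1
    refine h1.congr' ?_
    filter_upwards [hev] with t ht
    have : (1 - t : ℂ) ≠ 0 := sub_ne_zero.mpr (by exact_mod_cast ht.2.ne')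
    field_simp
    ring
  have hcont := continuous_qPochInf hq2
  have hcont8 := continuous_qPochInf hq8
  have hlhs : Tendsto (fun t : ℝ => qPochInf (q ^ 2) (q ^ 2) * qPochInf (t * q ^ 2) (q ^ 2) *
      qPochInf (q ^ 2 / t) (q ^ 2) * ((1 - t : ℂ) * L t)) (𝓝[<] 1)
      (𝓝 (qPochInf (q ^ 2) (q ^ 2) * qPochInf (1 * q ^ 2) (q ^ 2) *
      qPochInf (q ^ 2 / 1) (q ^ 2) * 1)) :=
    (((hcont.tendsto _).comp (hcast.mul_const _)).const_mul _ |>.mul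
      ((hcont.tendsto _).comp (tendsto_const_nhds.div hcast one_ne_zero))).mul hlimL
  have hx : Tendsto (fun t : ℝ => (t : ℂ) / q) (𝓝[<] 1) (𝓝 (1 / q)) := hcast.div_const q
  have hq1 : (1 / q) ^ 2 ≠ 0 := pow_ne_zero _ (one_div_ne_zero hq0)
  have hrhs : Tendsto (fun t : ℝ => thetaLambertCoeff q 1 * (t / q *
      (qPochInf (q ^ 8) (q ^ 8) * qPochInf ((t / q) ^ 2 * q ^ 8) (q ^ 8) *
        qPochInf (1 / (t / q) ^ 2) (q ^ 8)))) (𝓝[<] 1)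
      (𝓝 (thetaLambertCoeff q 1 * (1 / q * (qPochInf (q ^ 8) (q ^ 8) *
        qPochInf ((1 / q) ^ 2 * q ^ 8) (q ^ 8) * qPochInf (1 / (1 / q) ^ 2) (q ^ 8))))) :=
    (hx.mul ((((hcont8.tendsto _).comp ((hx.pow 2).mul_const _)).const_mul _).mul
      ((hcont8.tendsto _).comp (tendsto_const_nhds.div (hx.pow 2) hq1)))).const_mul _
  have hlim := tendsto_nhds_unique_of_eventuallyEq hlhs hrhs <| by
    filter_upwards [hev] with t ht
    have htc : (t : ℂ) ≠ 0 := by exact_mod_cast (hr.trans ht.1).ne'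
    have hx0 : (t : ℂ) / q ≠ 0 := div_ne_zero htc hq0
    have h := theta_mul_lambert_eq hq0 hq (x := t / q)
      (by rw [hnorm t ht.1, mul_div_cancel₀ _ hr.ne']; exact ht.2)
      (by rw [hnorm t ht.1, lt_div_iff₀ hr]; nlinarith [ht.1])
      (hasSum_jacobi_triple_product hq0 hq hx0) (hLs t ht.1 ht.2) (hasSum_theta_odd hq0 hq hx0)
    rw [div_mul_cancel₀ _ hq0, qPochInf_eq_one_sub_mul hq2 (t : ℂ),
      show q / (t / q) = q ^ 2 / t by field_simp] at h
    rw [← h]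
    ring
  have hA := qPochInf_sq_mul (norm_pow_lt_one hq four_ne_zero) (q ^ 2)
  have hB := qPochInf_sq_mul hq2 (q ^ 2)
  rw [← pow_mul, ← pow_add] at hA hB
  norm_num at hA hB hlim
  rw [show (q ^ 2)⁻¹ * q ^ 8 = q ^ 6 by field_simp] at hlim
  have h2 := qPochInf_self_pow_ne_zero hq two_ne_zero
  have h4 := qPochInf_self_pow_ne_zero hq four_ne_zero
  have h8 := qPochInf_self_pow_ne_zero hq (show 8 ≠ 0 by norm_num)
  rw [← hA] at hB
  have hB' : qPochInf (q ^ 6) (q ^ 8) * qPochInf (q ^ 2) (q ^ 8) =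
      qPochInf (q ^ 2) (q ^ 2) / qPochInf (q ^ 4) (q ^ 4) := by
    rw [← hB]; field_simp
  rw [mul_assoc (qPochInf (q ^ 8) (q ^ 8)), hB'] at hlim
  field_simp at hlim ⊢
  linear_combination -hlim

/-! ### The Lambert series as a quotient of theta functions -/

lemma theta4_eq_prod {q x z τ : ℂ} (hq : q = Complex.exp (2 * Real.pi * Complex.I * τ))
    (hq1 : ‖q‖ < 1) (hx : x = Complex.exp (2 * Complex.I * z)) :
    theta4 z (2 * τ) =
      qPochInf (q ^ 2) (q ^ 2) * qPochInf (x * q) (q ^ 2) * qPochInf (q / x) (q ^ 2) :=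
  (hasSum_theta4 hq hq1 hx).unique
    (hasSum_jacobi_triple_product (hq ▸ Complex.exp_ne_zero _) hq1 (hx ▸ Complex.exp_ne_zero _))

lemma theta1_eq_prod {q x z τ : ℂ} (hq : q = Complex.exp (2 * Real.pi * Complex.I * τ))
    (hq1 : ‖q‖ < 1) (hx : x = Complex.exp (2 * Complex.I * z)) :
    theta1 (2 * z) (8 * τ) = 2 * q * Complex.sin (2 * z) *
      (qPochInf (q ^ 8) (q ^ 8) * qPochInf (x ^ 2 * q ^ 8) (q ^ 8) *
        qPochInf (q ^ 8 / x ^ 2) (q ^ 8)) := by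
  have hx0 : x ≠ 0 := hx ▸ Complex.exp_ne_zero _
  rw [theta1_eq_neg_I_mul hq hx (hasSum_theta_odd (hq ▸ Complex.exp_ne_zero _) hq1 hx0),
    qPochInf_eq_one_sub_mul (norm_pow_lt_one hq1 (show 8 ≠ 0 by norm_num)) (1 / x ^ 2)]
  have hsin : 2 * Complex.sin (2 * z) = -Complex.I * (x - 1 / x) := by
    have h1 : x = Complex.exp (2 * z * Complex.I) := by rw [hx]; ring_nf
    have h2 : 1 / x = Complex.exp (-(2 * z) * Complex.I) := by
      rw [h1, one_div, ← Complex.exp_neg]; ring_nf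
    rw [h2, h1, Complex.sin]
    ring
  rw [mul_right_comm 2 q, hsin, one_div_mul_eq_div]
  field_simp

theorem hasSum_lambert_theta_quotient {q z τ : ℂ}
    (hq : q = Complex.exp (2 * Real.pi * Complex.I * τ)) (hτ : 0 < τ.im)
    (hz : |z.im| < Real.pi * τ.im) :
    theta4 z (2 * τ) ≠ 0 ∧
      HasSum (fun n : ℕ+ => lambertCoeff8 q n * Complex.sin (2 * n * z))
        (qPochInf (q ^ 4) (q ^ 4) * qPochInf (q ^ 2) (q ^ 2) ^ 2 / (2 * qPochInf (q ^ 8) (q ^ 8)) *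
          (theta1 (2 * z) (8 * τ) / theta4 z (2 * τ))) := by
  have hqn : ‖q‖ = Real.exp (-(2 * Real.pi * τ.im)) := by
    rw [hq, Complex.norm_exp]; congr 1; simp
  have hq0 : q ≠ 0 := hq ▸ Complex.exp_ne_zero _
  have hq1 : ‖q‖ < 1 := by
    rw [hqn, Real.exp_lt_one_iff]
    have := mul_pos Real.pi_pos hτ
    linarith
  obtain ⟨x, hx⟩ : ∃ x, x = Complex.exp (2 * Complex.I * z) := ⟨_, rfl⟩
  have hx0 : x ≠ 0 := hx ▸ Complex.exp_ne_zero _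
  have hxn : ‖x‖ = Real.exp (-(2 * z.im)) := by
    rw [hx, Complex.norm_exp]; congr 1; simp
  obtain ⟨hz1, hz2⟩ := abs_lt.mp hz
  have h1 : ‖q‖ * ‖x‖ < 1 := by
    rw [hqn, hxn, ← Real.exp_add, Real.exp_lt_one_iff]; linarith
  have h2 : ‖q‖ < ‖x‖ := by
    rw [hqn, hxn, Real.exp_lt_exp]; linarith
  have hq2 := norm_pow_lt_one hq1 two_ne_zero
  have hT0 : theta4 z (2 * τ) ≠ 0 := by
    rw [theta4_eq_prod hq hq1 hx]
    refine mul_ne_zero (mul_ne_zero (qPochInf_self_pow_ne_zero hq1 two_ne_zero)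
      (qPochInf_ne_zero_of_norm_lt_one hq2 ?_)) (qPochInf_ne_zero_of_norm_lt_one hq2 ?_)
    · rwa [norm_mul, mul_comm]
    · rwa [norm_div, div_lt_one (norm_pos_iff.mpr hx0)]
  refine ⟨hT0, ?_⟩
  have hL := (summable_norm_lambertCoeffInt hq0 hq1 h1 h2).of_norm.hasSum
  have hS := hasSum_theta_odd hq0 hq1 hx0
  have key := theta_mul_lambert_eq hq0 hq1 h1 h2 (hasSum_theta4 hq hq1 hx) hL hS
  rw [thetaLambertCoeff_one hq0 hq1] at key
  convert hasSum_lambertCoeff8_mul_sin hq0 hq1 hx hL using 1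
  rw [theta1_eq_neg_I_mul hq hx hS]
  have h8 := qPochInf_self_pow_ne_zero hq1 (show 8 ≠ 0 by norm_num)
  rw [← mul_div_assoc, div_eq_iff hT0, mul_assoc (-Complex.I / 2), mul_comm _ (theta4 _ _), key]
  field_simp

/-! ### The limit `z → 0` -/

lemma norm_lt_one_of_im_pos {q τ : ℂ} (hq : q = Complex.exp (2 * Real.pi * Complex.I * τ))
    (hτ : 0 < τ.im) : ‖q‖ < 1 := by
  have h := mul_pos Real.pi_pos hτ
  rw [hq, Complex.norm_exp, Real.exp_lt_one_iff]
  simp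
  linarith

lemma summable_natCast_mul_norm_lambertCoeff8 {q : ℂ} (hq0 : q ≠ 0) (hq : ‖q‖ < 1) :
    Summable fun n : ℕ+ => 2 * (n : ℝ) * ‖lambertCoeff8 q n‖ := by
  have hq' : ‖(‖q‖)‖ < 1 := by rwa [norm_norm]
  have h0 : Summable fun n : ℕ => (n : ℝ) ^ 1 * ‖q‖ ^ n :=
    summable_pow_mul_geometric_of_norm_lt_one 1 hq'
  have h := h0.mul_left (2 * (2 / (1 - ‖q‖ ^ 4)))
  have h' : Summable fun n : ℕ+ => 2 * (2 / (1 - ‖q‖ ^ 4)) * ((n : ℝ) ^ 1 * ‖q‖ ^ (n : ℕ)) :=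
    (summable_pnat_iff_summable_nat
      (f := fun n : ℕ => 2 * (2 / (1 - ‖q‖ ^ 4)) * ((n : ℝ) ^ 1 * ‖q‖ ^ n))).mpr h
  refine Summable.of_nonneg_of_le (fun n => by positivity) (fun n => ?_) h'
  have := norm_lambertCoeffInt_natCast_le hq n
  rw [lambertCoeffInt_natCast hq0 hq n.ne_zero] at this
  calc 2 * (n : ℝ) * ‖lambertCoeff8 q n‖
      ≤ 2 * (n : ℝ) * (2 / (1 - ‖q‖ ^ 4) * ‖q‖ ^ (n : ℕ)) := by gcongr
    _ = _ := by ring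

lemma tendsto_sin_mul_div (a : ℝ) :
    Tendsto (fun y : ℝ => Complex.sin (a * y) / y) (𝓝[≠] 0) (𝓝 a) := by
  have h : HasDerivAt (fun y : ℝ => Complex.sin (a * y)) a 0 := by
    have h1 : HasDerivAt (fun y : ℂ => Complex.sin (a * y)) a (0 : ℝ) := by
      simpa using ((hasDerivAt_id ((0 : ℝ) : ℂ)).const_mul (a : ℂ)).csin
    exact h1.comp_ofReal
  refine (hasDerivAt_iff_tendsto_slope.mp h).congr fun y => ?_
  simp [slope_def_module, div_eq_inv_mul]

theorem hasSum_natCast_mul_lambertCoeff8 {q τ : ℂ}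
    (hq : q = Complex.exp (2 * Real.pi * Complex.I * τ)) (hτ : 0 < τ.im) :
    HasSum (fun n : ℕ+ => (n : ℂ) * lambertCoeff8 q n)
      (q * qPochInf (q ^ 2) (q ^ 2) ^ 3 * qPochInf (q ^ 4) (q ^ 4) *
        qPochInf (q ^ 8) (q ^ 8) ^ 2 / qPochInf q q ^ 2) := by
  have hq0 : q ≠ 0 := hq ▸ Complex.exp_ne_zero _
  have hq1 := norm_lt_one_of_im_pos hq hτ
  have hq2 := norm_pow_lt_one hq1 two_ne_zero
  have hq8 := norm_pow_lt_one hq1 (show 8 ≠ 0 by norm_num)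
  have hs := summable_natCast_mul_norm_lambertCoeff8 hq0 hq1
  have hsum : Summable fun n : ℕ+ => (n : ℂ) * lambertCoeff8 q n := by
    refine (hs.mul_left (1 / 2)).of_norm_bounded fun n => ?_
    rw [norm_mul, Complex.norm_natCast]
    linarith
  let x : ℝ → ℂ := fun y => Complex.exp (2 * Complex.I * y)
  have hx : Tendsto x (𝓝[≠] 0) (𝓝 1) := by
    have : Continuous x := by fun_prop
    simpa [x] using (this.tendsto 0).mono_left nhdsWithin_le_nhds
  -- the sine series divided by `z`, as `z` tends to `0` along the reals
  have hleft : Tendsto (fun y : ℝ => ∑' n : ℕ+, lambertCoeff8 q n *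
      (Complex.sin (2 * n * y) / y)) (𝓝[≠] 0) (𝓝 (∑' n : ℕ+, lambertCoeff8 q n * (2 * n))) := by
    refine tendsto_tsum_of_dominated_convergence hs (fun n => ?_) ?_
    · simpa using (tendsto_sin_mul_div (2 * n)).const_mul (lambertCoeff8 q n)
    · filter_upwards [self_mem_nhdsWithin] with y hy n
      have h1 : ‖Complex.sin (2 * n * y) / y‖ ≤ 2 * n := by
        have e : Complex.sin (2 * n * y) = (Real.sin (2 * n * y) : ℝ) := by push_cast; rfl
        rw [e, norm_div, Complex.norm_real, Complex.norm_real,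
          div_le_iff₀ (norm_pos_iff.mpr hy), Real.norm_eq_abs, Real.norm_eq_abs]
        refine Real.abs_sin_le_abs.trans ?_
        rw [abs_mul, abs_of_nonneg (by positivity)]
      rw [norm_mul, mul_comm]
      gcongr
  have hT : ∀ y : ℝ, theta4 y (2 * τ) =
      qPochInf (q ^ 2) (q ^ 2) * qPochInf (x y * q) (q ^ 2) * qPochInf (q / x y) (q ^ 2) :=
    fun y => theta4_eq_prod hq hq1 rfl
  have hne := qPochInf_ne_zero_of_norm_lt_one hq2 hq1
  have h2 := qPochInf_self_pow_ne_zero hq1 two_ne_zero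
  have hright : Tendsto (fun y : ℝ => qPochInf (q ^ 4) (q ^ 4) * qPochInf (q ^ 2) (q ^ 2) ^ 2 /
      (2 * qPochInf (q ^ 8) (q ^ 8)) * (2 * q * (Complex.sin ((2 : ℝ) * y) / y) *
        (qPochInf (q ^ 8) (q ^ 8) * qPochInf (x y ^ 2 * q ^ 8) (q ^ 8) *
        qPochInf (q ^ 8 / x y ^ 2) (q ^ 8)) / (qPochInf (q ^ 2) (q ^ 2) *
        qPochInf (x y * q) (q ^ 2) * qPochInf (q / x y) (q ^ 2)))) (𝓝[≠] 0)
      (𝓝 (qPochInf (q ^ 4) (q ^ 4) * qPochInf (q ^ 2) (q ^ 2) ^ 2 /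
      (2 * qPochInf (q ^ 8) (q ^ 8)) * (2 * q * (2 : ℝ) *
        (qPochInf (q ^ 8) (q ^ 8) * qPochInf (1 ^ 2 * q ^ 8) (q ^ 8) *
        qPochInf (q ^ 8 / 1 ^ 2) (q ^ 8)) / (qPochInf (q ^ 2) (q ^ 2) *
        qPochInf (1 * q) (q ^ 2) * qPochInf (q / 1) (q ^ 2))))) := by
    have hc2 := continuous_qPochInf hq2
    have hc8 := continuous_qPochInf hq8
    have n1 := ((hc8.tendsto _).comp ((hx.pow 2).mul_const (q ^ 8))).const_mul
      (qPochInf (q ^ 8) (q ^ 8))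
    have n2 := (hc8.tendsto _).comp
      ((tendsto_const_nhds (x := q ^ 8)).div (hx.pow 2) (by norm_num))
    have d1 := ((hc2.tendsto _).comp (hx.mul_const q)).const_mul (qPochInf (q ^ 2) (q ^ 2))
    have d2 := (hc2.tendsto _).comp ((tendsto_const_nhds (x := q)).div hx one_ne_zero)
    refine ((((tendsto_sin_mul_div 2).const_mul (2 * q)).mul (n1.mul n2)).div (d1.mul d2)
      ?_).const_mul _
    simpa using ⟨h2, hne⟩
  have hlim := tendsto_nhds_unique_of_eventuallyEq hleft hright <| by
    filter_upwards [self_mem_nhdsWithin] with y hy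
    have h := ((hasSum_lambert_theta_quotient (z := y) hq hτ
      (by simpa using mul_pos Real.pi_pos hτ)).2).div_const (y : ℂ)
    simp_rw [mul_div_assoc] at h
    rw [h.tsum_eq, theta1_eq_prod hq hq1 rfl, hT]
    push_cast
    simp only [x]
    ring
  have hval : ∑' n : ℕ+, (n : ℂ) * lambertCoeff8 q n =
      (1 / 2) * ∑' n : ℕ+, lambertCoeff8 q n * (2 * n) := by
    rw [← tsum_mul_left]
    congr 1; ext n; ring
  have hP := qPochInf_sq_mul hq1 q
  rw [← sq] at hP
  have h8 := qPochInf_self_pow_ne_zero hq1 (show 8 ≠ 0 by norm_num)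
  convert hsum.hasSum using 1
  rw [hval, hlim, ← hP]
  simp only [one_pow, one_mul, div_one]
  push_cast
  field_simp

/-! ### The values at `z = π / 3` and `z = π / 4` -/

lemma sin_two_mul_pi_div_three (n : ℕ) :
    Complex.sin (2 * n * (Real.pi / 3 : ℝ)) = (√3 / 2 : ℝ) * (jacobiSym n 3 : ℂ) := by
  have key : Real.sin (2 * n * (Real.pi / 3)) = √3 / 2 * (jacobiSym n 3 : ℝ) := by
    have hn := Nat.div_add_mod n 3
    have hr := Nat.mod_lt n (show 3 > 0 by norm_num)
    rw [jacobiSym.mod_left]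
    norm_cast
    set k := n / 3
    set r := n % 3
    rw [← hn, show ((2 * (3 * k + r) : ℕ) : ℝ) * (Real.pi / 3) =
      2 * r * (Real.pi / 3) + k * (2 * Real.pi) by push_cast; ring, Real.sin_add_nat_mul_two_pi]
    interval_cases r
    · norm_num
    · rw [show 2 * ((1 : ℕ) : ℝ) * (Real.pi / 3) = Real.pi - Real.pi / 3 by push_cast; ring,
        Real.sin_pi_sub, Real.sin_pi_div_three]
      norm_num
    · rw [show 2 * ((2 : ℕ) : ℝ) * (Real.pi / 3) = Real.pi / 3 + Real.pi by push_cast; ring,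
        Real.sin_add_pi, Real.sin_pi_div_three, show jacobiSym ((2 : ℕ) : ℤ) 3 = -1 by norm_num]
      norm_num
  have := congrArg (fun y : ℝ => (y : ℂ)) key
  push_cast at this ⊢
  exact this

lemma sin_two_mul_pi_div_four {n : ℕ} (hn0 : n ≠ 0) :
    Complex.sin (2 * n * (Real.pi / 4 : ℝ)) = (jacobiSym (-4) n : ℂ) := by
  have key : Real.sin (2 * n * (Real.pi / 4)) = (jacobiSym (-4) n : ℝ) := by
    have hodd : n % 2 = 1 → jacobiSym (-4) n = ZMod.χ₄ n := fun h => by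
      have hodd' : Odd n := Nat.odd_iff.mpr h
      rw [show (-4 : ℤ) = -1 * 2 ^ 2 by norm_num, jacobiSym.mul_left, jacobiSym.sq_one', mul_one,
        jacobiSym.at_neg_one hodd']
      exact (Nat.coprime_two_left.mpr hodd')
    have hn := Nat.div_add_mod n 4
    have hr := Nat.mod_lt n (show 4 > 0 by norm_num)
    have hang : Real.sin (2 * n * (Real.pi / 4)) = Real.sin (2 * (n % 4 : ℕ) * (Real.pi / 4)) := by
      have hn' : (n : ℝ) = 4 * (n / 4 : ℕ) + (n % 4 : ℕ) := by exact_mod_cast hn.symm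
      rw [← Real.sin_add_nat_mul_two_pi (2 * (n % 4 : ℕ) * (Real.pi / 4)) (n / 4)]
      congr 1
      linear_combination (Real.pi / 2) * hn'
    have heven : n % 2 = 0 → jacobiSym (-4) n = 0 := fun h => by
      have : NeZero n := ⟨hn0⟩
      rw [jacobiSym.eq_zero_iff_not_coprime]
      intro hg
      have h2 : 2 ∣ Int.gcd (-4) n := Int.dvd_gcd (by norm_num) (by omega)
      rw [hg] at h2
      omega
    rw [hang]
    obtain h | h | h | h : n % 4 = 0 ∨ n % 4 = 1 ∨ n % 4 = 2 ∨ n % 4 = 3 := by omega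
    · rw [h, heven (by omega)]; simp
    · rw [h, hodd (by omega), ZMod.χ₄_nat_one_mod_four h,
        show 2 * ((1 : ℕ) : ℝ) * (Real.pi / 4) = Real.pi / 2 by push_cast; ring]
      simp
    · rw [h, heven (by omega),
        show 2 * ((2 : ℕ) : ℝ) * (Real.pi / 4) = Real.pi by push_cast; ring]
      simp
    · rw [h, hodd (by omega), ZMod.χ₄_nat_three_mod_four h,
        show 2 * ((3 : ℕ) : ℝ) * (Real.pi / 4) = Real.pi / 2 + Real.pi by push_cast; ring,
        Real.sin_add_pi]
      simp
  have := congrArg (fun y : ℝ => (y : ℂ)) key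
  push_cast at this ⊢
  exact this

theorem hasSum_jacobiSym_three_mul_lambertCoeff8 {q τ : ℂ}
    (hq : q = Complex.exp (2 * Real.pi * Complex.I * τ)) (hτ : 0 < τ.im) :
    HasSum (fun n : ℕ+ => (jacobiSym n 3 : ℂ) * lambertCoeff8 q n)
      (q * qPochInf q q * qPochInf (q ^ 4) (q ^ 4) * qPochInf (q ^ 6) (q ^ 6) *
        qPochInf (q ^ 24) (q ^ 24) / (qPochInf (q ^ 3) (q ^ 3) * qPochInf (q ^ 8) (q ^ 8))) := by
  have hq1 := norm_lt_one_of_im_pos hq hτ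
  have hq2 := norm_pow_lt_one hq1 two_ne_zero
  have hq8 := norm_pow_lt_one hq1 (show 8 ≠ 0 by norm_num)
  obtain ⟨ω, hω⟩ : ∃ ω, ω = Complex.exp (2 * Complex.I * (Real.pi / 3 : ℝ)) := ⟨_, rfl⟩
  have h3 : (√3 / 2 : ℝ) ≠ 0 := by positivity
  have h3c : ((√3 / 2 : ℝ) : ℂ) ≠ 0 := by exact_mod_cast h3
  have hωv : ω = ((-1 / 2 : ℝ) : ℂ) + ((√3 / 2 : ℝ) : ℂ) * Complex.I := by
    have e1 : Real.cos (2 * (Real.pi / 3)) = -1 / 2 := by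
      rw [show 2 * (Real.pi / 3) = Real.pi - Real.pi / 3 by ring, Real.cos_pi_sub,
        Real.cos_pi_div_three]; norm_num
    have e2 : Real.sin (2 * (Real.pi / 3)) = √3 / 2 := by
      rw [show 2 * (Real.pi / 3) = Real.pi - Real.pi / 3 by ring, Real.sin_pi_sub,
        Real.sin_pi_div_three]
    rw [hω, ← e1, ← e2, Complex.ofReal_cos, Complex.ofReal_sin, ← Complex.exp_mul_I]
    congr 1; push_cast; ring
  have hrel : 1 + ω + ω ^ 2 = 0 := by
    have hs : ((√3 / 2 : ℝ) : ℂ) ^ 2 = 3 / 4 := by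
      rw [← Complex.ofReal_pow, div_pow, Real.sq_sqrt (by norm_num)]; norm_num
    rw [hωv]
    push_cast at hs ⊢
    linear_combination hs * Complex.I ^ 2 + 3 / 4 * Complex.I_sq
  have hω0 : ω ≠ 0 := hω ▸ Complex.exp_ne_zero _
  have hinv : ∀ a : ℂ, a / ω = ω ^ 2 * a := fun a => by
    rw [div_eq_iff hω0]; linear_combination (a * (1 - ω)) * hrel
  have hinv2 : ∀ a : ℂ, a / ω ^ 2 = ω * a := fun a => by
    rw [div_eq_iff (pow_ne_zero _ hω0)]; linear_combination (a * (1 - ω)) * hrel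
  obtain ⟨-, h⟩ := hasSum_lambert_theta_quotient (z := (Real.pi / 3 : ℝ)) hq hτ
    (by simpa using mul_pos Real.pi_pos hτ)
  have hsin : Complex.sin (2 * (Real.pi / 3 : ℝ)) = (√3 / 2 : ℝ) := by
    simpa using sin_two_mul_pi_div_three 1
  have hc8 := qPochInf_mul_cube_roots hq8 hrel (q ^ 8)
  have hc2 := qPochInf_mul_cube_roots hq2 hrel q
  have h4 := theta4_eq_prod hq hq1 hω
  have h1 := theta1_eq_prod hq hq1 hω
  rw [hinv] at h4
  rw [hsin, hinv2] at h1
  simp_rw [sin_two_mul_pi_div_three] at h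
  have h' := h.div_const ((√3 / 2 : ℝ) : ℂ)
  have hP := qPochInf_sq_mul hq1 q
  have hP3 := qPochInf_sq_mul (norm_pow_lt_one hq1 three_ne_zero) (q ^ 3)
  rw [← sq] at hP
  rw [← pow_mul, ← pow_add] at hP3
  rw [← pow_mul] at hc8 hc2
  norm_num at hc8 hc2 hP3
  have n2 := qPochInf_self_pow_ne_zero hq1 two_ne_zero
  have n3 := qPochInf_self_pow_ne_zero hq1 three_ne_zero
  have n6 := qPochInf_self_pow_ne_zero hq1 (show 6 ≠ 0 by norm_num)
  have n8 := qPochInf_self_pow_ne_zero hq1 (show 8 ≠ 0 by norm_num)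
  have no := qPochInf_ne_zero_of_norm_lt_one hq2 hq1
  have key : theta4 (Real.pi / 3 : ℝ) (2 * τ) * qPochInf q (q ^ 2) * qPochInf (q ^ 6) (q ^ 6) =
      qPochInf (q ^ 2) (q ^ 2) * qPochInf (q ^ 3) (q ^ 3) := by
    rw [h4, ← hP3, ← hc2]
    ring
  have key1 : theta1 (2 * (Real.pi / 3 : ℝ)) (8 * τ) =
      2 * q * (√3 / 2 : ℝ) * qPochInf (q ^ 24) (q ^ 24) := by
    rw [h1, ← hc8]
    ring
  have key4 : theta4 (Real.pi / 3 : ℝ) (2 * τ) = qPochInf (q ^ 2) (q ^ 2) *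
      qPochInf (q ^ 3) (q ^ 3) / (qPochInf q (q ^ 2) * qPochInf (q ^ 6) (q ^ 6)) := by
    rw [eq_div_iff (mul_ne_zero no n6), ← key]; ring
  have hval : q * qPochInf q q * qPochInf (q ^ 4) (q ^ 4) * qPochInf (q ^ 6) (q ^ 6) *
      qPochInf (q ^ 24) (q ^ 24) / (qPochInf (q ^ 3) (q ^ 3) * qPochInf (q ^ 8) (q ^ 8)) =
      qPochInf (q ^ 4) (q ^ 4) * qPochInf (q ^ 2) (q ^ 2) ^ 2 / (2 * qPochInf (q ^ 8) (q ^ 8)) *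
        (theta1 (2 * (Real.pi / 3 : ℝ)) (8 * τ) / theta4 (Real.pi / 3 : ℝ) (2 * τ)) /
      (√3 / 2 : ℝ) := by
    rw [key1, key4, ← hP]
    field_simp
  rw [hval]
  refine h'.congr_fun fun n => ?_
  field_simp

theorem hasSum_jacobiSym_neg_four_mul_lambertCoeff8 {q τ : ℂ}
    (hq : q = Complex.exp (2 * Real.pi * Complex.I * τ)) (hτ : 0 < τ.im) :
    HasSum (fun n : ℕ+ => (jacobiSym (-4) n : ℂ) * lambertCoeff8 q n)
      (q * qPochInf (q ^ 2) (q ^ 2) ^ 2 * qPochInf (q ^ 16) (q ^ 16) ^ 2 /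
        (qPochInf (q ^ 4) (q ^ 4) * qPochInf (q ^ 8) (q ^ 8))) := by
  have hq1 := norm_lt_one_of_im_pos hq hτ
  have hq2 := norm_pow_lt_one hq1 two_ne_zero
  have hq4 := norm_pow_lt_one hq1 four_ne_zero
  have hq8 := norm_pow_lt_one hq1 (show 8 ≠ 0 by norm_num)
  have hI : Complex.exp (2 * Complex.I * (Real.pi / 4 : ℝ)) = Complex.I := by
    rw [show 2 * Complex.I * (Real.pi / 4 : ℝ) = Real.pi / 2 * Complex.I by push_cast; ring,
      Complex.exp_pi_div_two_mul_I]
  obtain ⟨-, h⟩ := hasSum_lambert_theta_quotient (z := (Real.pi / 4 : ℝ)) hq hτ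
    (by simpa using mul_pos Real.pi_pos hτ)
  have hsin : Complex.sin (2 * (Real.pi / 4 : ℝ)) = 1 := by
    rw [show (2 : ℂ) * (Real.pi / 4 : ℝ) = Real.pi / 2 by push_cast; ring, Complex.sin_pi_div_two]
  have h4 := theta4_eq_prod hq hq1 hI.symm
  have h1 := theta1_eq_prod hq hq1 hI.symm
  rw [show q / Complex.I = -(Complex.I * q) by rw [Complex.div_I]; ring, mul_assoc,
    qPochInf_mul_neg hq2, mul_pow, Complex.I_sq, ← pow_mul] at h4
  rw [hsin, Complex.I_sq, div_neg, div_one] at h1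
  have e1 := qPochInf_mul_neg hq8 (q ^ 8)
  have e2 := qPochInf_mul_neg hq4 (q ^ 2)
  have e3 := qPochInf_sq_mul hq2 (q ^ 2)
  have e4 := qPochInf_sq_mul hq4 (q ^ 4)
  rw [← pow_mul] at e1
  rw [← pow_mul, ← pow_mul] at e2
  rw [← pow_mul, ← pow_add] at e3 e4
  norm_num at h1 h4 e1 e2 e3 e4
  have n2 := qPochInf_self_pow_ne_zero hq1 two_ne_zero
  have n4 := qPochInf_self_pow_ne_zero hq1 four_ne_zero
  have n8 := qPochInf_self_pow_ne_zero hq1 (show 8 ≠ 0 by norm_num)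
  have key : theta4 (Real.pi / 4 : ℝ) (2 * τ) =
      qPochInf (q ^ 4) (q ^ 4) ^ 2 / qPochInf (q ^ 8) (q ^ 8) := by
    rw [eq_div_iff n8]
    push_cast
    rw [h4, ← e3]
    linear_combination qPochInf (q ^ 4) (q ^ 4) * (qPochInf (q ^ 8) (q ^ 8) * e2 + e4)
  have key1 : theta1 (2 * (Real.pi / 4 : ℝ)) (8 * τ) =
      2 * q * (qPochInf (q ^ 16) (q ^ 16) ^ 2 / qPochInf (q ^ 8) (q ^ 8)) := by
    push_cast
    rw [h1, ← e1]
    field_simp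
  rw [key, key1] at h
  have hval : q * qPochInf (q ^ 2) (q ^ 2) ^ 2 * qPochInf (q ^ 16) (q ^ 16) ^ 2 /
      (qPochInf (q ^ 4) (q ^ 4) * qPochInf (q ^ 8) (q ^ 8)) =
      qPochInf (q ^ 4) (q ^ 4) * qPochInf (q ^ 2) (q ^ 2) ^ 2 / (2 * qPochInf (q ^ 8) (q ^ 8)) *
        (2 * q * (qPochInf (q ^ 16) (q ^ 16) ^ 2 / qPochInf (q ^ 8) (q ^ 8)) /
          (qPochInf (q ^ 4) (q ^ 4) ^ 2 / qPochInf (q ^ 8) (q ^ 8))) := by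
    field_simp
  rw [hval]
  refine h.congr_fun fun n => ?_
  rw [sin_two_mul_pi_div_four n.ne_zero, mul_comm]

/-! ### Eta quotients -/

lemma eta_natCast_mul {τ w : ℂ} (hw : w = Complex.exp (2 * Real.pi * Complex.I * τ / 24)) (k : ℕ) :
    ModularForm.eta (k * τ) = w ^ k * qPochInf ((w ^ 24) ^ k) ((w ^ 24) ^ k) := by
  have h1 : Function.Periodic.qParam 24 (k * τ) = w ^ k := by
    rw [Function.Periodic.qParam, hw, ← Complex.exp_nat_mul]
    congr 1; push_cast; ring
  have h2 : Function.Periodic.qParam 1 (k * τ) = (w ^ 24) ^ k := by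
    rw [Function.Periodic.qParam, hw, ← Complex.exp_nat_mul, ← Complex.exp_nat_mul]
    congr 1; push_cast; ring
  rw [ModularForm.eta, h1, qPochInf]
  simp only [ModularForm.eta_q, h2, pow_succ']

theorem mainTheorem8 (τ : ℂ) (hτ : 0 < τ.im) (q : ℂ)
    (hq : q = Complex.exp (2 * Real.pi * Complex.I * τ)) :
    (∀ z : ℂ, |z.im| < Real.pi * τ.im →
      theta4 z (2 * τ) ≠ 0 ∧
      HasSum (fun n : ℕ+ => lambertCoeff8 q n * Complex.sin (2 * n * z))
        (qPochInf (q ^ 4) (q ^ 4) * qPochInf (q ^ 2) (q ^ 2) ^ 2 / (2 * qPochInf (q ^ 8) (q ^ 8)) *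
          (theta1 (2 * z) (8 * τ) / theta4 z (2 * τ)))) ∧
    (HasSum (fun n : ℕ+ => (n : ℂ) * lambertCoeff8 q n)
        (q * qPochInf (q ^ 2) (q ^ 2) ^ 3 * qPochInf (q ^ 4) (q ^ 4) *
          qPochInf (q ^ 8) (q ^ 8) ^ 2 / qPochInf q q ^ 2) ∧
      q * qPochInf (q ^ 2) (q ^ 2) ^ 3 * qPochInf (q ^ 4) (q ^ 4) *
          qPochInf (q ^ 8) (q ^ 8) ^ 2 / qPochInf q q ^ 2 =
        ModularForm.eta (2 * τ) ^ 3 * ModularForm.eta (4 * τ) * ModularForm.eta (8 * τ) ^ 2 /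
          ModularForm.eta τ ^ 2) ∧
    (HasSum (fun n : ℕ+ => (jacobiSym n 3 : ℂ) * lambertCoeff8 q n)
        (q * qPochInf q q * qPochInf (q ^ 4) (q ^ 4) * qPochInf (q ^ 6) (q ^ 6) *
          qPochInf (q ^ 24) (q ^ 24) / (qPochInf (q ^ 3) (q ^ 3) * qPochInf (q ^ 8) (q ^ 8))) ∧
      q * qPochInf q q * qPochInf (q ^ 4) (q ^ 4) * qPochInf (q ^ 6) (q ^ 6) *
          qPochInf (q ^ 24) (q ^ 24) / (qPochInf (q ^ 3) (q ^ 3) * qPochInf (q ^ 8) (q ^ 8)) =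
        ModularForm.eta τ * ModularForm.eta (4 * τ) * ModularForm.eta (6 * τ) *
          ModularForm.eta (24 * τ) / (ModularForm.eta (3 * τ) * ModularForm.eta (8 * τ))) ∧
    (HasSum (fun n : ℕ+ => (jacobiSym (-4) n : ℂ) * lambertCoeff8 q n)
        (q * qPochInf (q ^ 2) (q ^ 2) ^ 2 * qPochInf (q ^ 16) (q ^ 16) ^ 2 /
          (qPochInf (q ^ 4) (q ^ 4) * qPochInf (q ^ 8) (q ^ 8))) ∧
      q * qPochInf (q ^ 2) (q ^ 2) ^ 2 * qPochInf (q ^ 16) (q ^ 16) ^ 2 /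
          (qPochInf (q ^ 4) (q ^ 4) * qPochInf (q ^ 8) (q ^ 8)) =
        ModularForm.eta (2 * τ) ^ 2 * ModularForm.eta (16 * τ) ^ 2 /
          (ModularForm.eta (4 * τ) * ModularForm.eta (8 * τ))) := by
  have hq1 := norm_lt_one_of_im_pos hq hτ
  obtain ⟨w, hw⟩ : ∃ w, w = Complex.exp (2 * Real.pi * Complex.I * τ / 24) := ⟨_, rfl⟩
  have hw0 : w ≠ 0 := hw ▸ Complex.exp_ne_zero _
  have hwq : w ^ 24 = q := by
    rw [hw, hq, ← Complex.exp_nat_mul]; congr 1; push_cast; ring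
  have heta := eta_natCast_mul hw
  rw [hwq] at heta
  have E1 := heta 1
  have E2 := heta 2
  have E3 := heta 3
  have E4 := heta 4
  have E6 := heta 6
  have E8 := heta 8
  have E16 := heta 16
  have E24 := heta 24
  simp only [Nat.cast_one, one_mul, pow_one, Nat.cast_ofNat] at E1 E2 E3 E4 E6 E8 E16 E24
  have n1 := qPochInf_ne_zero_of_norm_lt_one hq1 hq1
  have n3 := qPochInf_self_pow_ne_zero hq1 three_ne_zero
  have n4 := qPochInf_self_pow_ne_zero hq1 four_ne_zero
  have n8 := qPochInf_self_pow_ne_zero hq1 (show 8 ≠ 0 by norm_num)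
  refine ⟨fun z hz => hasSum_lambert_theta_quotient hq hτ hz,
    ⟨hasSum_natCast_mul_lambertCoeff8 hq hτ, ?_⟩,
    ⟨hasSum_jacobiSym_three_mul_lambertCoeff8 hq hτ, ?_⟩,
    ⟨hasSum_jacobiSym_neg_four_mul_lambertCoeff8 hq hτ, ?_⟩⟩
  · rw [E1, E2, E4, E8, div_eq_div_iff (by positivity) (by positivity)]
    linear_combination (-w ^ 2 * qPochInf (q ^ 2) (q ^ 2) ^ 3 * qPochInf (q ^ 4) (q ^ 4) *
      qPochInf (q ^ 8) (q ^ 8) ^ 2 * qPochInf q q ^ 2) * hwq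
  · rw [E1, E3, E4, E6, E8, E24, div_eq_div_iff (by positivity) (by positivity)]
    linear_combination (-w ^ 11 * qPochInf q q * qPochInf (q ^ 4) (q ^ 4) *
      qPochInf (q ^ 6) (q ^ 6) * qPochInf (q ^ 24) (q ^ 24) * qPochInf (q ^ 3) (q ^ 3) *
      qPochInf (q ^ 8) (q ^ 8)) * hwq
  · rw [E2, E4, E8, E16, div_eq_div_iff (by positivity) (by positivity)]
    linear_combination (-w ^ 12 * qPochInf (q ^ 2) (q ^ 2) ^ 2 * qPochInf (q ^ 16) (q ^ 16) ^ 2 *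
      qPochInf (q ^ 4) (q ^ 4) * qPochInf (q ^ 8) (q ^ 8)) * hwq
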